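/- A weighted graph $(E,\omega)$ consists of countable sets $E^0$ (vertices) and $E^{\mathrm{st}}$ (structured edges), maps $s,r:E^{\mathrm{st}}\to E^0$ and a weight map $\omega:E^{\mathrm{st}}\to\{1,2,3,\dots\}$. It is assumed to be row-finite, i.e. $s^{-1}(v)$ is finite for every $v\in E^0$. For $v$ not a sink (i.e. $s^{-1}(v)\neq\emptyset$) put $\omega(v)=\max\{\omega(\alpha)\mid\alpha\in s^{-1}(v)\}$. Let $E^1$ be the set of edges $\alpha_i$ with $\alpha\in E^{\mathrm{st}}$, $1\le i\le\omega(\alpha)$, and $(E^1)^*$ the set of symbols $\alpha_i^*$ with $\alpha_i\in E^1$, these edges and symbols being pairwise distinct and distinct from the vertices. For a unital (not necessarily commutative) ring $R$, the weighted Leavitt path algebra $L_R(E,\omega)$ is the (not necessarily unital) ring $R\langle X\rangle/I$. Here $R\langle X\rangle$ is the free left $R$-module on the nonempty words over $X=E^0\sqcup E^1\sqcup(E^1)^*$, with multiplication $(\sum_x r_x x)(\sum_y t_y y)=\sum_{x,y} r_xt_y\,xy$ and right action $(\sum_x r_x x)t=\sum_x r_xt\,x$ of $R$, and $I$ is the two-sided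 ideal and $R$-subbimodule generated by the relations 1. $vw=\delta_{vw}v$ for all $v,w\in E^0$; 2. $s(\alpha)\alpha_i=\alpha_i=\alpha_i r(\alpha)$ and $r(\alpha)\alpha_i^*=\alpha_i^*=\alpha_i^*s(\alpha)$ for all $\alpha\in E^{\mathrm{st}}$ and $1\le i\le\omega(\alpha)$; 3. $\sum_{\alpha\in s^{-1}(v)}\alpha_i\alpha_j^*=\delta_{ij}v$ for all $v\in E^0$ that are not sinks and $1\le i,j\le\omega(v)$; 4. $\sum_{1\le i\le\max\{\omega(\alpha),\omega(\beta)\}}\alpha_i^*\beta_i=\delta_{\alpha\beta}r(\alpha)$ for all $\alpha,\beta\in E^{\mathrm{st}}$; where in (3) and (4) $\alpha_i$ and $\alpha_i^*$ are read as $0$ if $i>\omega(\alpha)$. $(E,\omega)$ is called an LV-graph if $E^{\mathrm{st}}\ne\emptyset$, $(E,\omega)$ is connected (any two vertices are joined by a path in which structured edges may be traversed in either direction), $\omega(\alpha)\ge2$ for all $\alpha\in E^{\mathrm{st}}$, and for every $v\in E^0$ that is not a sink there are at least two $\alpha\in s^{-1}(v)$ with $\omega(\alpha)=\omega(v)$.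 The Jacobson radical of a not necessarily unital ring $A$ is the sum of all left ideals of $A$ each of whose elements $a$ is left quasi-regular, i.e. satisfies $b+a=ba$ for some $b\in A$. **Theorem.** Let $(E,\omega)$ be an LV-graph and let $R$ be a domain (a nonzero, not necessarily commutative, unital ring without zero divisors). Then the Jacobson radical of $L_R(E,\omega)$ is zero. -/

import Mathlib

open scoped MulOpposite

/-- A row-finite weighted graph with vertex set `V` and set of structured edges `S`.
A structured edge `α` stands for the `ω α ≥ 1` edges `α₁, …, α_{ω α}`; these are indexed here by
`Fin (ω α)`, so that the index `i : Fin (ω α)` denotes the edge `α_{i+1}`. -/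
structure WeightedGraph (V : Type*) (S : Type*) where
  /-- the source map -/
  s : S → V
  /-- the range map -/
  r : S → V
  /-- the weight map -/
  ω : S → ℕ
  ω_pos : ∀ α, 1 ≤ ω α
  /-- row-finiteness: every vertex emits only finitely many structured edges -/
  finite_out : ∀ v, {α | s α = v}.Finite

namespace WeightedGraph

variable {V S : Type*} (E : WeightedGraph V S)

/-- The finite set `s⁻¹(v)`. -/
noncomputable def out (v : V) : Finset S := (E.finite_out v).toFinset

/-- `ω(v) = max {ω(α) | α ∈ s⁻¹(v)}` if `v` is not a sink (and `0` if `v` is a sink). -/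
noncomputable def vertexWeight (v : V) : ℕ := (E.out v).sup E.ω

/-- There is an element `x` of `E¹ ∪ (E¹)*` with `s(x) = u` and `r(x) = v`, where
`s(αᵢ) = s(α)`, `r(αᵢ) = r(α)`, `s(αᵢ*) = r(α)` and `r(αᵢ*) = s(α)`. -/
def Step (u v : V) : Prop :=
  ∃ (α : S) (_ : Fin (E.ω α)), (E.s α = u ∧ E.r α = v) ∨ (E.r α = u ∧ E.s α = v)

/-- There is a generalised path (possibly of length zero) from `u` to `v`. -/
def Reach (u v : V) : Prop := Relation.ReflTransGen E.Step u v

/-- LV-graphs: connected weighted graphs that have edges and satisfy condition (LV). -/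
structure IsLVGraph : Prop where
  two_le_weight : ∀ α, 2 ≤ E.ω α
  two_le_card : ∀ v, (E.out v).Nonempty →
    2 ≤ ((E.out v).filter fun α => E.ω α = E.vertexWeight v).card
  has_edges : Nonempty S
  connected : ∀ u v, E.Reach u v

/-- The set of generators `X = E⁰ ⊔ E¹ ⊔ (E¹)*`. -/
inductive Gen : Type _
  | vertex (v : V) : Gen
  | edge (α : S) (i : Fin (E.ω α)) : Gen
  | ghost (α : S) (i : Fin (E.ω α)) : Gen

variable (R : Type*) [Ring R]

/-- The free (nonunital) `R`-ring `R⟨X⟩`: the free left `R`-module on the nonempty words over `X`,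
with `(r x) (s y) = (r s) (x y)` for `r s : R` and words `x y`. -/
abbrev FreeRRing : Type _ := MonoidAlgebra R (FreeSemigroup E.Gen)

/-- A generator as an element of `R⟨X⟩`. -/
noncomputable def ι (x : E.Gen) : E.FreeRRing R := MonoidAlgebra.single (FreeSemigroup.of x) 1

/-- The vertex `v` in `R⟨X⟩`. -/
noncomputable def vtx (v : V) : E.FreeRRing R := E.ι R (.vertex v)

/-- The element `α_{i+1}` of `R⟨X⟩`, which is zero if `i + 1 > ω(α)`. -/
noncomputable def edg (α : S) (i : ℕ) : E.FreeRRing R :=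
  if h : i < E.ω α then E.ι R (.edge α ⟨i, h⟩) else 0

/-- The element `α_{i+1}*` of `R⟨X⟩`, which is zero if `i + 1 > ω(α)`. -/
noncomputable def gho (α : S) (i : ℕ) : E.FreeRRing R :=
  if h : i < E.ω α then E.ι R (.ghost α ⟨i, h⟩) else 0

open Classical in
/-- The defining relations (1)-(4) of the weighted Leavitt path algebra. -/
inductive Rel : E.FreeRRing R → E.FreeRRing R → Prop
  | vertex_mul (v w : V) : Rel (E.vtx R v * E.vtx R w) (if v = w then E.vtx R v else 0)
  | source_mul_edge (α : S) (i : ℕ) (hi : i < E.ω α) :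
      Rel (E.vtx R (E.s α) * E.edg R α i) (E.edg R α i)
  | edge_mul_range (α : S) (i : ℕ) (hi : i < E.ω α) :
      Rel (E.edg R α i * E.vtx R (E.r α)) (E.edg R α i)
  | range_mul_ghost (α : S) (i : ℕ) (hi : i < E.ω α) :
      Rel (E.vtx R (E.r α) * E.gho R α i) (E.gho R α i)
  | ghost_mul_source (α : S) (i : ℕ) (hi : i < E.ω α) :
      Rel (E.gho R α i * E.vtx R (E.s α)) (E.gho R α i)
  | sum_edge_ghost (v : V) (i j : ℕ) (hi : i < E.vertexWeight v) (hj : j < E.vertexWeight v) :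
      Rel (∑ α ∈ E.out v, E.edg R α i * E.gho R α j) (if i = j then E.vtx R v else 0)
  | sum_ghost_edge (α β : S) :
      Rel (∑ i ∈ Finset.range (max (E.ω α) (E.ω β)), E.gho R α i * E.edg R β i)
        (if α = β then E.vtx R (E.r α) else 0)

/-- The ideal of the `R`-ring `R⟨X⟩` generated by the defining relations: the smallest two-sided
ideal which is an `R`-subbimodule and contains all the relations. -/
noncomputable def relIdeal : TwoSidedIdeal (E.FreeRRing R) :=
  sInf {I | (∀ a b, E.Rel R a b → a - b ∈ I) ∧
    (∀ (c : R), ∀ a ∈ I, c • a ∈ I ∧ MulOpposite.op c • a ∈ I)}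

/-- The weighted Leavitt path algebra `L_R(E, ω) = R⟨X⟩ / I`. -/
abbrev LeavittPathAlgebra : Type _ := (E.relIdeal R).ringCon.Quotient

end WeightedGraph

section JacobsonRadical

variable {A : Type*} [NonUnitalRing A]

/-- An element `a` of a (not necessarily unital) ring is left quasi-regular if `b + a = b a` for
some `b`. -/
def IsLeftQuasiregular (a : A) : Prop := ∃ b : A, b + a = b * a

/-- An additive subgroup of `A` is a left quasi-regular left ideal. -/
structure IsLeftQuasiregularLeftIdeal (I : AddSubgroup A) : Prop where
  mul_mem : ∀ (x : A), ∀ a ∈ I, x * a ∈ I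
  quasiregular : ∀ a ∈ I, IsLeftQuasiregular a

variable (A) in
/-- The Jacobson radical of a not necessarily unital ring: the sum of all its left quasi-regular
left ideals. -/
def jacobsonRadical : AddSubgroup A := sSup {I | IsLeftQuasiregularLeftIdeal I}

end JacobsonRadical

/-! The algebra has a normal form whose leading terms, measured by word length, multiply almost as
in a free algebra. At every vertex that is not a sink, fix a special edge `σ u` of maximal weight.
With indices counted from `0`, relation (3) rewrites `αᵢ αⱼ*` for `α` special, and relation (4)
rewrites `α₀* β₀`; words avoiding these pairs are normal. As in the diamond lemma, the normal words
ending in `v` form a basis of `L v`. For independence, `L` is made to act on their span: the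
relations hold there because the overlaps `αᵢ α₀* β₀` and `αᵢ* βᵢ βⱼ*` resolve
(`sum_act_edge_act_ghost`, `sum_act_ghost_act_edge`). For spanning, evaluating words back in `L`
commutes with the action (`toL_mul_evalWords`), so `f v` is determined by the action of `f` on the
empty word `v`.

Rewriting a forbidden pair `x y` gives shorter words minus a sum of pairs `z w` of the same length.
The mixed pair `z y` is then neither forbidden nor produced by any rewriting (`Red.not_bad`,
`Red.not_red`), so its coefficient in a product is a single product of coefficients, nonzero over a
domain. Condition (LV) provides a replacement pair that is again normal. Hence lengths add for
factors that meet at a common vertex (`exists_mulWords_apply_ne_zero`).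

It follows that `b + a = b a` is impossible for `a` in a corner `v L v` with a term of positive
length: either the right side is too long, or `b` is a scalar multiple of `v`, and comparing
coefficients fails. By connectedness every nonzero `a` has some `g a v` of this kind. If `a` lies in
a left quasi-regular left ideal, then `v g a` is quasi-regular, hence so is `g a v`: a
contradiction. -/

namespace WeightedGraph

/-! ### Normal words -/

/-- Letters `αᵢ` and `αᵢ*`, where the index `i` is an arbitrary natural number. -/
inductive Letter (S : Type*) : Type _
  | edge (α : S) (i : ℕ) : Letter S
  | ghost (α : S) (i : ℕ) : Letter S

variable {V S : Type*} (E : WeightedGraph V S)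

/-- A choice of an edge of maximal weight at every vertex that is not a sink. -/
structure IsSpecial (σ : V → S) : Prop where
  source : ∀ α, E.s (σ (E.s α)) = E.s α
  weight : ∀ α, E.ω (σ (E.s α)) = E.vertexWeight (E.s α)

variable (σ : V → S) (v : V)

/-- The source of a letter. -/
def src : Letter S → V
  | .edge α _ => E.s α
  | .ghost α _ => E.r α

/-- The range of a letter. -/
def rng : Letter S → V
  | .edge α _ => E.r α
  | .ghost α _ => E.s α

/-- The index of the letter is in the permitted range. -/
def Valid : Letter S → Prop
  | .edge α i => i < E.ω α
  | .ghost α i => i < E.ω α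

/-- The forbidden words of length two. -/
def Bad : Letter S → Letter S → Prop
  | .edge α _, .ghost β _ => α = β ∧ σ (E.s α) = α
  | .ghost _ i, .edge _ j => i = 0 ∧ j = 0
  | _, _ => False

/-- Normal words ending in the vertex `v`; the empty word stands for `v` itself. -/
def Nod : List (Letter S) → Prop
  | [] => True
  | [x] => E.Valid x ∧ E.rng x = v
  | x :: y :: l => E.Valid x ∧ E.rng x = E.src y ∧ ¬ E.Bad σ x y ∧ Nod (y :: l)

/-- The source of a word ending in `v`. -/
def start : List (Letter S) → V
  | [] => v
  | x :: _ => E.src x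

/-- A letter followed by the given word starts with a forbidden word. -/
def BadHead (x : Letter S) : List (Letter S) → Prop
  | [] => False
  | y :: _ => E.Bad σ x y

variable {E σ v}

theorem nod_cons {x : Letter S} {l : List (Letter S)} :
    E.Nod σ v (x :: l) ↔
      E.Valid x ∧ E.rng x = E.start v l ∧ ¬ E.BadHead σ x l ∧ E.Nod σ v l := by
  cases l <;> simp [Nod, start, BadHead]

theorem Nod.tail {x : Letter S} {l : List (Letter S)} (h : E.Nod σ v (x :: l)) :
    E.Nod σ v l := (nod_cons.1 h).2.2.2

theorem Nod.valid {x : Letter S} {l : List (Letter S)} (h : E.Nod σ v (x :: l)) :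
    E.Valid x := (nod_cons.1 h).1

theorem Nod.rng_eq {x : Letter S} {l : List (Letter S)} (h : E.Nod σ v (x :: l)) :
    E.rng x = E.start v l := (nod_cons.1 h).2.1

/-- Replacing the first letter of a normal word. -/
theorem Nod.replace_head {x y : Letter S} {l : List (Letter S)} (h : E.Nod σ v (x :: l))
    (hy : E.Valid y) (hr : E.rng y = E.rng x)
    (hb : ∀ z, E.Bad σ y z → E.Bad σ x z) : E.Nod σ v (y :: l) := by
  rw [nod_cons] at h ⊢
  refine ⟨hy, hr.trans h.2.1, ?_, h.2.2.2⟩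
  have h3 := h.2.2.1
  cases l with
  | nil => exact id
  | cons z l => exact fun h4 => h3 (hb z h4)

/-- Normality only constrains adjacent letters, so two normal words sharing the letter `z` can be
glued along it. -/
theorem Nod.append {p : List (Letter S)} {u : V} {z : Letter S} {l : List (Letter S)}
    (h : E.Nod σ u (p ++ [z])) (h' : E.Nod σ v (z :: l)) : E.Nod σ v (p ++ z :: l) := by
  induction p with
  | nil => exact h'
  | cons x p ih =>
    rw [List.cons_append, nod_cons] at h ⊢
    refine ⟨h.1, ?_, ?_, ih h.2.2.2⟩
    · rw [h.2.1]; cases p <;> rfl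
    · have := h.2.2.1
      cases p <;> exact this

/-- Replacing the last letter of a normal word. -/
theorem Nod.replace_last {p : List (Letter S)} {u w : V} {x z : Letter S}
    (h : E.Nod σ u (p ++ [x])) (hz : E.Valid z) (hr : E.rng z = w) (hs : E.src z = E.src x)
    (hb : ∀ y, E.Bad σ y z → E.Bad σ y x) : E.Nod σ w (p ++ [z]) := by
  induction p with
  | nil => exact ⟨hz, hr⟩
  | cons y p ih =>
    rw [List.cons_append, nod_cons] at h ⊢
    refine ⟨h.1, ?_, ?_, ih h.2.2.2⟩
    · rw [h.2.1]; cases p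
      · exact hs.symm
      · rfl
    · have := h.2.2.1
      cases p
      · exact fun h4 => this (hb _ h4)
      · exact this

theorem Nod.last {p : List (Letter S)} {u : V} {x : Letter S} (h : E.Nod σ u (p ++ [x])) :
    E.Valid x ∧ E.rng x = u := by
  induction p with
  | nil => exact h
  | cons y p ih => exact ih (Nod.tail h)

theorem Nod.suffix {p l : List (Letter S)} (h : E.Nod σ v (p ++ l)) : E.Nod σ v l := by
  induction p with
  | nil => exact h
  | cons y p ih => exact ih (Nod.tail h)

/-! ### The action of letters on normal words -/

noncomputable section

variable (E σ v) (R : Type*) [Ring R]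

open Classical in
/-- The basis vector of a word, read as zero if the word is not normal. -/
def bas (l : List (Letter S)) : List (Letter S) →₀ R :=
  if E.Nod σ v l then Finsupp.single l 1 else 0

open Classical in
/-- The normal form of the product of a forbidden word of length two with a word. -/
def red : Letter S → Letter S → List (Letter S) → (List (Letter S) →₀ R)
  | .edge α i, .ghost β j, l =>
    if α = β ∧ σ (E.s α) = α then
      (if i = j then E.bas σ v R l else 0) -
        ∑ γ ∈ (E.out (E.s α)).erase α, E.bas σ v R (.edge γ i :: .ghost γ j :: l)
    else 0
  | .ghost α i, .edge β j, l =>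
    if i = 0 ∧ j = 0 then
      (if α = β then E.bas σ v R l else 0) -
        ∑ k ∈ Finset.Ico 1 (E.ω β), E.bas σ v R (.ghost α k :: .edge β k :: l)
    else 0
  | _, _, _ => 0

open Classical in
/-- The product of a letter and a normal word. -/
def actBasis (x : Letter S) : List (Letter S) → (List (Letter S) →₀ R)
  | [] => E.bas σ v R [x]
  | y :: l => E.bas σ v R (x :: y :: l) +
      if E.Nod σ v (y :: l) ∧ E.Valid x ∧ E.rng x = E.src y then E.red σ v R x y l else 0

/-- The action of a letter. -/
def act (x : Letter S) : (List (Letter S) →₀ R) →ₗ[R] (List (Letter S) →₀ R) :=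
  Finsupp.linearCombination R (E.actBasis σ v R x)

open Classical in
/-- The action of a vertex. -/
def proj (u : V) : (List (Letter S) →₀ R) →ₗ[R] (List (Letter S) →₀ R) :=
  Finsupp.linearCombination R
    fun l => if E.start v l = u then E.bas σ v R l else 0

variable {E σ v R}

theorem bas_of_nod {l : List (Letter S)} (h : E.Nod σ v l) :
    E.bas σ v R l = Finsupp.single l 1 := if_pos h

theorem bas_of_not_nod {l : List (Letter S)} (h : ¬ E.Nod σ v l) :
    E.bas σ v R l = 0 := if_neg h

theorem act_single (x : Letter S) (l : List (Letter S)) (c : R) :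
    E.act σ v R x (Finsupp.single l c) = c • E.actBasis σ v R x l := by
  simp [act]

theorem actBasis_of_not_nod {x : Letter S} {l : List (Letter S)} (h : ¬ E.Nod σ v l) :
    E.actBasis σ v R x l = 0 := by
  cases l with
  | nil => exact absurd trivial h
  | cons y l =>
    rw [actBasis, bas_of_not_nod (fun h' => h h'.tail), if_neg (fun h' => h h'.1), add_zero]

theorem act_bas (x : Letter S) (l : List (Letter S)) :
    E.act σ v R x (E.bas σ v R l) = E.actBasis σ v R x l := by
  by_cases h : E.Nod σ v l
  · rw [bas_of_nod h, act_single, one_smul]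
  · rw [bas_of_not_nod h, actBasis_of_not_nod h, map_zero]

open Classical in
theorem proj_bas (u : V) (l : List (Letter S)) :
    E.proj σ v R u (E.bas σ v R l) = if E.start v l = u then E.bas σ v R l else 0 := by
  by_cases h : E.Nod σ v l
  · conv_lhs => rw [bas_of_nod h]
    simp [proj]
  · simp [bas_of_not_nod h]

theorem red_of_not_bad {x y : Letter S} {l : List (Letter S)} (h : ¬ E.Bad σ x y) :
    E.red σ v R x y l = 0 := by
  cases x <;> cases y <;> simp only [red] <;> exact if_neg h

/-- No composability is needed: `bas` vanishes off normal words, so both sides are zero when the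
extended word fails to be one for another reason. -/
theorem act_bas_of_not_badHead {x : Letter S} {l : List (Letter S)} (h : ¬ E.BadHead σ x l) :
    E.act σ v R x (E.bas σ v R l) = E.bas σ v R (x :: l) := by
  rw [act_bas]
  cases l with
  | nil => rfl
  | cons y l => rw [actBasis, red_of_not_bad h, ite_self, add_zero]

theorem act_bas_of_rng_ne {x : Letter S} {l : List (Letter S)} (h : E.rng x ≠ E.start v l) :
    E.act σ v R x (E.bas σ v R l) = 0 := by
  rw [act_bas]
  cases l with
  | nil => exact bas_of_not_nod fun h' => h h'.rng_eq
  | cons y l =>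
    rw [actBasis, bas_of_not_nod (fun h' => h h'.rng_eq), if_neg (fun h' => h h'.2.2), add_zero]

theorem act_bas_of_not_valid {x : Letter S} {l : List (Letter S)} (h : ¬ E.Valid x) :
    E.act σ v R x (E.bas σ v R l) = 0 := by
  rw [act_bas]
  cases l with
  | nil => exact bas_of_not_nod fun h' => h h'.valid
  | cons y l =>
    rw [actBasis, bas_of_not_nod (fun h' => h h'.valid), if_neg (fun h' => h h'.2.1), add_zero]

theorem act_bas_of_bad {x y : Letter S} {l : List (Letter S)} (hx : E.Valid x)
    (hb : E.Bad σ x y) (hn : E.Nod σ v (y :: l)) (hr : E.rng x = E.src y) :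
    E.act σ v R x (E.bas σ v R (y :: l)) = E.red σ v R x y l := by
  rw [act_bas, actBasis, bas_of_not_nod (fun h' => ((nod_cons (l := y :: l)).1 h').2.2.1 hb), if_pos ⟨hn, hx, hr⟩,
    zero_add]

open Classical in
theorem act_edge_bas_ghost {α : S} {i j : ℕ} {l : List (Letter S)} (hi : i < E.ω α)
    (hα : σ (E.s α) = α) (hn : E.Nod σ v (.ghost α j :: l)) :
    E.act σ v R (.edge α i) (E.bas σ v R (.ghost α j :: l)) =
      (if i = j then E.bas σ v R l else 0) -
        ∑ γ ∈ (E.out (E.s α)).erase α, E.bas σ v R (.edge γ i :: .ghost γ j :: l) := by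
  have hb : E.Bad σ (.edge α i) (.ghost α j) := ⟨rfl, hα⟩
  have hv : E.Valid (.edge α i) := hi
  rw [act_bas_of_bad hv hb hn rfl]
  simp [red, hα]

open Classical in
theorem act_ghost_bas_edge {α β : S} {l : List (Letter S)}
    (hs : E.s α = E.s β) (hn : E.Nod σ v (.edge β 0 :: l)) :
    E.act σ v R (.ghost α 0) (E.bas σ v R (.edge β 0 :: l)) =
      (if α = β then E.bas σ v R l else 0) -
        ∑ k ∈ Finset.Ico 1 (E.ω β), E.bas σ v R (.ghost α k :: .edge β k :: l) := by
  have hb : E.Bad σ (.ghost α 0) (.edge β 0) := ⟨rfl, rfl⟩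
  have hv : E.Valid (.ghost α 0) := E.ω_pos α
  rw [act_bas_of_bad hv hb hn hs]
  simp [red]

/-! ### Relations (3) and (4) hold for the action -/

theorem mem_out {α : S} {u : V} : α ∈ E.out u ↔ E.s α = u := by simp [out]

theorem IsSpecial.weight_le (hσ : E.IsSpecial σ) (α : S) : E.ω α ≤ E.ω (σ (E.s α)) := by
  rw [hσ.weight]
  exact Finset.le_sup (f := E.ω) (mem_out.2 rfl)

-- The special summand is rewritten as `δᵢⱼ l` minus the words `γᵢ γⱼ* l` with `γ` not special, and
-- these are exactly the other summands.
open Classical in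
theorem sum_act_edge_act_ghost_of_not_badHead (hσ : E.IsSpecial σ) {u : V} {l : List (Letter S)}
    {i j : ℕ} (hi : i < E.vertexWeight u) (hj : j < E.vertexWeight u)
    (hl : E.start v l = u) (hb : ∀ α ∈ E.out u, ¬ E.BadHead σ (.ghost α j) l) :
    ∑ α ∈ E.out u, E.act σ v R (.edge α i) (E.act σ v R (.ghost α j) (E.bas σ v R l)) =
      if i = j then E.bas σ v R l else 0 := by
  by_cases hn : E.Nod σ v l
  swap
  · simp [bas_of_not_nod hn]
  obtain ⟨α, hα⟩ : (E.out u).Nonempty := by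
    by_contra h
    simp [vertexWeight, Finset.not_nonempty_iff_eq_empty.1 h] at hi
  rw [mem_out] at hα
  have hs : E.s (σ u) = u := hα ▸ hσ.source α
  have hw : E.ω (σ u) = E.vertexWeight u := hα ▸ hσ.weight α
  have hmem : σ u ∈ E.out u := mem_out.2 hs
  rw [← Finset.add_sum_erase _ _ hmem]
  have h1 : E.act σ v R (.edge (σ u) i) (E.act σ v R (.ghost (σ u) j) (E.bas σ v R l)) =
      (if i = j then E.bas σ v R l else 0) -
        ∑ γ ∈ (E.out u).erase (σ u), E.bas σ v R (.edge γ i :: .ghost γ j :: l) := by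
    have hn' : E.Nod σ v (.ghost (σ u) j :: l) :=
      nod_cons.2 ⟨show j < E.ω (σ u) from hw ▸ hj, by simp [rng, hs, hl], hb _ hmem, hn⟩
    rw [act_bas_of_not_badHead (hb _ hmem), act_edge_bas_ghost (hw ▸ hi) (by rw [hs]) hn', hs]
  rw [h1]
  have h2 : ∀ γ ∈ (E.out u).erase (σ u),
      E.act σ v R (.edge γ i) (E.act σ v R (.ghost γ j) (E.bas σ v R l)) =
        E.bas σ v R (.edge γ i :: .ghost γ j :: l) := by
    intro γ hγ
    rw [Finset.mem_erase, mem_out] at hγ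
    rw [act_bas_of_not_badHead (hb _ (mem_out.2 hγ.2)), act_bas_of_not_badHead]
    rintro ⟨-, h⟩
    rw [hγ.2] at h
    exact hγ.1 h.symm
  rw [Finset.sum_congr rfl h2, sub_add_cancel]

-- The remaining case is the overlap `αᵢ α₀* β₀`. Rewriting `α₀* β₀` leaves words in which `αₖ*`
-- meets `βₖ` with `k ≥ 1`, and to these the previous lemma applies.
open Classical in
theorem sum_act_edge_act_ghost (hσ : E.IsSpecial σ) (u : V) (l : List (Letter S))
    {i j : ℕ} (hi : i < E.vertexWeight u) (hj : j < E.vertexWeight u) :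
    ∑ α ∈ E.out u, E.act σ v R (.edge α i) (E.act σ v R (.ghost α j) (E.bas σ v R l)) =
      if i = j then E.proj σ v R u (E.bas σ v R l) else 0 := by
  by_cases hn : E.Nod σ v l
  swap
  · simp [bas_of_not_nod hn]
  rw [proj_bas]
  by_cases hl : E.start v l = u
  swap
  · rw [if_neg hl, ite_self]
    refine Finset.sum_eq_zero fun α hα => ?_
    rw [act_bas_of_rng_ne, map_zero]
    rw [mem_out] at hα
    simpa [rng, hα] using Ne.symm hl
  rw [if_pos hl]
  by_cases hb : ∀ α ∈ E.out u, ¬ E.BadHead σ (.ghost α j) l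
  · exact sum_act_edge_act_ghost_of_not_badHead hσ hi hj hl hb
  push Not at hb
  obtain ⟨α₀, hα₀, hb⟩ := hb
  cases l with
  | nil => exact hb.elim
  | cons y l =>
  cases y with
  | ghost => exact hb.elim
  | edge β k =>
  obtain ⟨rfl, rfl⟩ : j = 0 ∧ k = 0 := hb
  have hβ : E.s β = u := hl
  have hkey : ∀ i, E.Nod σ v (.edge β i :: l) ∨ E.ω β ≤ i := by
    intro i
    by_cases hi : i < E.ω β
    · refine .inl (hn.replace_head hi rfl ?_)
      rintro (_ | _) h
      · exact h
      · exact h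
    · exact .inr (not_lt.1 hi)
  have h1 : ∀ α ∈ E.out u, E.act σ v R (.ghost α 0) (E.bas σ v R (.edge β 0 :: l)) =
      (if α = β then E.bas σ v R l else 0) -
        ∑ k ∈ Finset.Ico 1 (E.ω β),
          E.act σ v R (.ghost α k) (E.bas σ v R (.edge β k :: l)) := by
    intro α hα
    rw [mem_out] at hα
    rw [act_ghost_bas_edge (hα.trans hβ.symm) hn]
    congr 1
    refine Finset.sum_congr rfl fun k hk => ?_
    rw [act_bas_of_not_badHead]
    rintro ⟨h, -⟩
    simp [h] at hk
  have h2 : ∀ α ∈ E.out u,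
      E.act σ v R (.edge α i) (E.act σ v R (.ghost α 0) (E.bas σ v R (.edge β 0 :: l))) =
      (if α = β then E.act σ v R (.edge α i) (E.bas σ v R l) else 0) -
        ∑ k ∈ Finset.Ico 1 (E.ω β), E.act σ v R (.edge α i)
          (E.act σ v R (.ghost α k) (E.bas σ v R (.edge β k :: l))) := by
    intro α hα
    rw [h1 α hα, map_sub, map_sum]
    split_ifs <;> simp
  rw [Finset.sum_congr rfl h2, Finset.sum_sub_distrib, Finset.sum_comm, Finset.sum_ite_eq',
    if_pos (mem_out.2 hβ)]
  have h3 : ∀ k ∈ Finset.Ico 1 (E.ω β), ∑ α ∈ E.out u, E.act σ v R (.edge α i)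
      (E.act σ v R (.ghost α k) (E.bas σ v R (.edge β k :: l))) =
        if i = k then E.bas σ v R (.edge β k :: l) else 0 := by
    intro k hk
    rw [Finset.mem_Ico] at hk
    refine sum_act_edge_act_ghost_of_not_badHead hσ hi ?_ hβ ?_
    · refine hk.2.trans_le ?_
      rw [← hβ]
      exact Finset.le_sup (f := E.ω) (mem_out.2 rfl)
    · rintro α - ⟨h, -⟩
      omega
  rw [Finset.sum_congr rfl h3, Finset.sum_ite_eq]
  have h4 : E.act σ v R (.edge β i) (E.bas σ v R l) = E.bas σ v R (.edge β i :: l) := by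
    refine act_bas_of_not_badHead fun h => (nod_cons.1 hn).2.2.1 ?_
    cases l with
    | nil => exact h
    | cons y l => cases y <;> exact h
  rw [h4]
  -- What remains is `βᵢ l` minus itself when `1 ≤ i < ω(β)`. For `i = 0` nothing is subtracted; for
  -- `i ≥ ω(β)` the index is out of range and the word is zero.
  by_cases hi0 : i = 0
  · subst hi0; simp
  · rw [if_neg hi0]
    split_ifs with h
    · rw [sub_self]
    · rw [sub_zero]
      refine bas_of_not_nod fun h' => h ?_
      exact Finset.mem_Ico.2 ⟨Nat.one_le_iff_ne_zero.2 hi0, h'.valid⟩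

-- Here the summand with index `0` is rewritten, and it cancels all the others. The bound `N` is
-- free because terms with `i ≥ ω(β)` vanish; the overlap case below uses one `N` for several edges.
open Classical in
theorem sum_act_ghost_act_edge_of_not_badHead {α β : S} {l : List (Letter S)} {N : ℕ}
    (hN : E.ω β ≤ N) (hl : E.start v l = E.r β) (hb : ∀ i, ¬ E.BadHead σ (.edge β i) l) :
    ∑ i ∈ Finset.range N,
        E.act σ v R (.ghost α i) (E.act σ v R (.edge β i) (E.bas σ v R l)) =
      if α = β then E.bas σ v R l else 0 := by
  by_cases hn : E.Nod σ v l
  swap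
  · simp [bas_of_not_nod hn]
  simp only [act_bas_of_not_badHead (hb _)]
  by_cases hs : E.s α = E.s β
  swap
  · rw [if_neg (fun h => hs (by rw [h]))]
    exact Finset.sum_eq_zero fun i _ => act_bas_of_rng_ne hs
  have hβ := E.ω_pos β
  have hn' : E.Nod σ v (.edge β 0 :: l) := nod_cons.2 ⟨hβ, hl.symm, hb 0, hn⟩
  rw [Finset.range_eq_Ico, Finset.sum_eq_sum_Ico_succ_bot (by omega), act_ghost_bas_edge hs hn']
  rw [sub_add_eq_add_sub, sub_eq_iff_eq_add]
  congr 1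
  rw [← Finset.sum_subset (Finset.Ico_subset_Ico_right hN)]
  · refine Finset.sum_congr rfl fun k hk => ?_
    rw [act_bas_of_not_badHead]
    rintro ⟨h, -⟩
    simp [h] at hk
  · intro k hk hk'
    rw [bas_of_not_nod, map_zero]
    intro h
    have : k < E.ω β := h.valid
    simp at hk hk'
    omega

-- The remaining case is the overlap `αᵢ* βᵢ βⱼ*` with `β` special. Rewriting `βᵢ βⱼ*` leaves terms
-- with `γ ≠ β` out of the same vertex, and the previous lemma sums these over `i`.
open Classical in
theorem sum_act_ghost_act_edge (hσ : E.IsSpecial σ) (α β : S) (l : List (Letter S)) {N : ℕ}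
    (hN : E.ω β ≤ N) :
    ∑ i ∈ Finset.range N,
        E.act σ v R (.ghost α i) (E.act σ v R (.edge β i) (E.bas σ v R l)) =
      if α = β then E.proj σ v R (E.r α) (E.bas σ v R l) else 0 := by
  by_cases hn : E.Nod σ v l
  swap
  · simp [bas_of_not_nod hn]
  rw [proj_bas]
  by_cases hl : E.start v l = E.r β
  swap
  · have : (if α = β then if E.start v l = E.r α then E.bas σ v R l else 0 else 0) = 0 := by
      split_ifs with h h'
      · exact absurd (h ▸ h') hl
      · rfl
      · rfl
    rw [this]
    refine Finset.sum_eq_zero fun i hi => ?_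
    rw [act_bas_of_rng_ne (Ne.symm hl), map_zero]
  have : (if α = β then if E.start v l = E.r α then E.bas σ v R l else 0 else 0) =
      if α = β then E.bas σ v R l else 0 := by
    split_ifs with h h'
    · rfl
    · exact absurd (h ▸ hl) h'
    · rfl
  rw [this]
  by_cases hb : ∀ i, ¬ E.BadHead σ (.edge β i) l
  · exact sum_act_ghost_act_edge_of_not_badHead hN hl hb
  push Not at hb
  obtain ⟨i₀, hb⟩ := hb
  cases l with
  | nil => exact hb.elim
  | cons y l =>
  cases y with
  | edge => exact hb.elim
  | ghost γ j =>
  obtain ⟨rfl, hβ⟩ : β = γ ∧ _ := hb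
  have hj : j < E.ω β := hn.valid
  have hsl : E.start v l = E.s β := hn.rng_eq.symm
  have hgood : ∀ α, ¬ E.BadHead σ (.ghost α j) l := by
    intro α h
    refine (nod_cons.1 hn).2.2.1 ?_
    cases l with
    | nil => exact h
    | cons y l => cases y <;> exact h
  have h1 : ∀ i ∈ Finset.range N,
      E.act σ v R (.ghost α i) (E.act σ v R (.edge β i) (E.bas σ v R (.ghost β j :: l))) =
      (if i = j then E.act σ v R (.ghost α i) (E.bas σ v R l) else 0) -
        ∑ γ ∈ (E.out (E.s β)).erase β, E.act σ v R (.ghost α i)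
          (E.act σ v R (.edge γ i) (E.bas σ v R (.ghost γ j :: l))) := by
    intro i _
    have hγ : ∀ γ ∈ (E.out (E.s β)).erase β,
        E.act σ v R (.edge γ i) (E.bas σ v R (.ghost γ j :: l)) =
          E.bas σ v R (.edge γ i :: .ghost γ j :: l) := by
      intro γ hγ
      rw [Finset.mem_erase, mem_out] at hγ
      refine act_bas_of_not_badHead ?_
      rintro ⟨-, h⟩
      rw [hγ.2, hβ] at h
      exact hγ.1 h.symm
    rw [Finset.sum_congr rfl fun γ h => by rw [hγ γ h]]
    by_cases hi : i < E.ω β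
    · rw [act_edge_bas_ghost hi hβ hn, map_sub, map_sum]
      split_ifs <;> simp
    -- For `i ≥ ω(β)` everything is zero: the special edge has maximal weight, so `γᵢ` is out of
    -- range as well, and `j < ω(β)` excludes `i = j`.
    · rw [act_bas_of_not_valid (E := E) (x := .edge β i) hi, map_zero, if_neg (by omega), zero_sub]
      rw [Finset.sum_eq_zero, neg_zero]
      intro γ hγ'
      rw [Finset.mem_erase, mem_out] at hγ'
      rw [bas_of_not_nod, map_zero]
      intro h
      have h2 : i < E.ω γ := h.valid
      have h3 := hσ.weight_le γ
      rw [hγ'.2, hβ] at h3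
      omega
  rw [Finset.sum_congr rfl h1, Finset.sum_sub_distrib, Finset.sum_ite_eq',
    if_pos (Finset.mem_range.2 (by omega)), Finset.sum_comm]
  have h2 : ∀ γ ∈ (E.out (E.s β)).erase β, ∑ i ∈ Finset.range N, E.act σ v R (.ghost α i)
      (E.act σ v R (.edge γ i) (E.bas σ v R (.ghost γ j :: l))) =
        if α = γ then E.bas σ v R (.ghost γ j :: l) else 0 := by
    intro γ hγ
    rw [Finset.mem_erase, mem_out] at hγ
    refine sum_act_ghost_act_edge_of_not_badHead ?_ rfl ?_
    · have h3 := hσ.weight_le γ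
      rw [hγ.2, hβ] at h3
      omega
    · rintro i ⟨-, h⟩
      rw [hγ.2, hβ] at h
      exact hγ.1 h.symm
  rw [Finset.sum_congr rfl h2, Finset.sum_ite_eq, act_bas_of_not_badHead (hgood α)]
  by_cases hαβ : α = β
  · subst hαβ; simp
  · rw [if_neg hαβ]
    split_ifs with h
    · rw [sub_self]
    · rw [sub_zero]
      refine bas_of_not_nod fun h' => h ?_
      exact Finset.mem_erase.2 ⟨hαβ, mem_out.2 (h'.rng_eq.trans hsl)⟩

end

end WeightedGraph

/-! ### The representation of the algebra on normal words -/

namespace WeightedGraph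

noncomputable section

variable {V S : Type*} (E : WeightedGraph V S) (σ : V → S) (v : V) (R : Type*) [Ring R]

/-- The action of a generator on words. -/
def genAct : E.Gen → (List (Letter S) →₀ R) →ₗ[R] (List (Letter S) →₀ R)
  | .vertex u => E.proj σ v R u
  | .edge α i => E.act σ v R (.edge α i)
  | .ghost α i => E.act σ v R (.ghost α i)

/-- The action of a monomial on words. -/
def monAct : FreeSemigroup E.Gen →ₙ* AddMonoid.End (List (Letter S) →₀ R) :=
  FreeSemigroup.lift fun x => (E.genAct σ v R x).toAddMonoidHom

variable {E σ v R}

theorem monAct_mul (w w' : FreeSemigroup E.Gen) (m : List (Letter S) →₀ R) :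
    E.monAct σ v R (w * w') m = E.monAct σ v R w (E.monAct σ v R w' m) := by
  rw [map_mul]
  rfl

theorem monAct_smul (w : FreeSemigroup E.Gen) (c : R) (m : List (Letter S) →₀ R) :
    E.monAct σ v R w (c • m) = c • E.monAct σ v R w m := by
  induction w generalizing m with
  | ih1 x => exact map_smul (E.genAct σ v R x) c m
  | ih2 x y hx hy => rw [monAct_mul, hy, hx, monAct_mul]

variable (E σ v R)

/-- The representation of `R⟨X⟩` on normal words ending in `v`. -/
def rep : E.FreeRRing R →ₙ+* AddMonoid.End (List (Letter S) →₀ R) where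
  toFun := MonoidAlgebra.liftNC
    (Module.toAddMonoidEnd R (List (Letter S) →₀ R) : R →+ AddMonoid.End _) (E.monAct σ v R)
  map_zero' := map_zero _
  map_add' := map_add _
  map_mul' a b := by
    -- Words act `R`-linearly, so they commute with the coefficients.
    refine MonoidAlgebra.liftNC_mul _ _ _ _ fun {x y} _ => ?_
    ext1 m
    exact (monAct_smul _ _ _).symm

variable {E σ v R}

theorem rep_single (w : FreeSemigroup E.Gen) (c : R) (m : List (Letter S) →₀ R) :
    E.rep σ v R (MonoidAlgebra.single w c) m = c • E.monAct σ v R w m := by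
  have h : E.rep σ v R (MonoidAlgebra.single w c) =
      Module.toAddMonoidEnd R (List (Letter S) →₀ R) c * E.monAct σ v R w :=
    MonoidAlgebra.liftNC_single _ _ _ _
  rw [h]
  rfl

theorem rep_ι (x : E.Gen) (m : List (Letter S) →₀ R) :
    E.rep σ v R (E.ι R x) m = E.genAct σ v R x m := by
  rw [ι, rep_single, one_smul]
  rfl

theorem rep_mul (f g : E.FreeRRing R) (m : List (Letter S) →₀ R) :
    E.rep σ v R (f * g) m = E.rep σ v R f (E.rep σ v R g m) := by
  rw [map_mul]
  rfl

theorem rep_add (f g : E.FreeRRing R) (m : List (Letter S) →₀ R) :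
    E.rep σ v R (f + g) m = E.rep σ v R f m + E.rep σ v R g m := by
  rw [map_add]
  rfl

theorem rep_zero (m : List (Letter S) →₀ R) : E.rep σ v R 0 m = 0 := by
  rw [map_zero]; rfl

theorem rep_sum {ι : Type*} (s : Finset ι) (f : ι → E.FreeRRing R) (m : List (Letter S) →₀ R) :
    E.rep σ v R (∑ i ∈ s, f i) m = ∑ i ∈ s, E.rep σ v R (f i) m := by
  classical
  induction s using Finset.induction_on with
  | empty => simp
  | insert i s hi ih => rw [Finset.sum_insert hi, Finset.sum_insert hi, rep_add, ih]

theorem rep_smul (c : R) (f : E.FreeRRing R) (m : List (Letter S) →₀ R) :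
    E.rep σ v R (c • f) m = c • E.rep σ v R f m := by
  induction f using MonoidAlgebra.induction_linear with
  | zero => rw [smul_zero, rep_zero, smul_zero]
  | add f g hf hg => rw [smul_add, rep_add, hf, hg, rep_add, smul_add]
  | single w r => rw [MonoidAlgebra.smul_single', rep_single, rep_single, mul_smul]

/-- Needed because the ideal of relations is a subbimodule: it shows that the kernel of the
representation is stable under right scalars too. -/
theorem rep_op_smul (c : R) (f : E.FreeRRing R) (m : List (Letter S) →₀ R) :
    E.rep σ v R (MulOpposite.op c • f) m = E.rep σ v R f (c • m) := by
  induction f using MonoidAlgebra.induction_linear with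
  | zero => rw [smul_zero, rep_zero, rep_zero]
  | add f g hf hg => simp only [smul_add, rep_add, hf, hg]
  | single w r =>
    rw [MonoidAlgebra.smul_single, rep_single, rep_single, monAct_smul, smul_smul]
    rfl

theorem act_single_one (x : Letter S) (l : List (Letter S)) :
    E.act σ v R x (Finsupp.single l 1) = E.act σ v R x (E.bas σ v R l) := by
  rw [act_bas, act_single, one_smul]

theorem proj_single_one (u : V) (l : List (Letter S)) :
    E.proj σ v R u (Finsupp.single l 1) = E.proj σ v R u (E.bas σ v R l) := by
  classical
  rw [proj_bas, proj, Finsupp.linearCombination_single, one_smul]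

theorem act_of_not_valid {x : Letter S} (h : ¬ E.Valid x) : E.act σ v R x = 0 := by
  ext1 l
  ext1
  simp [act_single_one, act_bas_of_not_valid h]

theorem rep_vtx (u : V) (m : List (Letter S) →₀ R) :
    E.rep σ v R (E.vtx R u) m = E.proj σ v R u m := rep_ι _ _

theorem rep_edg (α : S) (i : ℕ) (m : List (Letter S) →₀ R) :
    E.rep σ v R (E.edg R α i) m = E.act σ v R (.edge α i) m := by
  rw [edg]
  split_ifs with h
  · exact rep_ι _ _
  · rw [act_of_not_valid (x := .edge α i) h, rep_zero, LinearMap.zero_apply]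

theorem rep_gho (α : S) (i : ℕ) (m : List (Letter S) →₀ R) :
    E.rep σ v R (E.gho R α i) m = E.act σ v R (.ghost α i) m := by
  rw [gho]
  split_ifs with h
  · exact rep_ι _ _
  · rw [act_of_not_valid (x := .ghost α i) h, rep_zero, LinearMap.zero_apply]

/-- For noncommutative `R` a general element does not act `R`-linearly, so linearity is assumed of
the two elements compared. -/
theorem ext_single {f g : E.FreeRRing R}
    (h : ∀ l : List (Letter S),
      E.rep σ v R f (Finsupp.single l 1) = E.rep σ v R g (Finsupp.single l 1))
    (hf : ∀ (c : R) m, E.rep σ v R f (c • m) = c • E.rep σ v R f m)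
    (hg : ∀ (c : R) m, E.rep σ v R g (c • m) = c • E.rep σ v R g m) :
    E.rep σ v R f = E.rep σ v R g := by
  ext1 m
  induction m using Finsupp.induction_linear with
  | zero => simp
  | add m n hm hn => rw [map_add, map_add, hm, hn]
  | single l c =>
    have : Finsupp.single l c = c • Finsupp.single l (1 : R) := by simp
    rw [this, hf, hg, h]

theorem proj_proj [DecidableEq V] (u w : V) (m : List (Letter S) →₀ R) :
    E.proj σ v R u (E.proj σ v R w m) = if u = w then E.proj σ v R u m else 0 := by
  classical
  induction m using Finsupp.induction_linear with
  | zero => simp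
  | add m n hm hn => rw [map_add, map_add, hm, hn, map_add]; split_ifs <;> simp
  | single l c =>
    have : Finsupp.single l c = c • Finsupp.single l (1 : R) := by simp
    simp only [this, map_smul, proj_single_one, proj_bas]
    split_ifs with h1 h2 h2 <;> simp_all [proj_bas, eq_comm]

/-- Rewriting preserves the source of the first letter, and a surviving shorter word starts at that
vertex as well. -/
theorem proj_src_act (x : Letter S) (m : List (Letter S) →₀ R) :
    E.proj σ v R (E.src x) (E.act σ v R x m) = E.act σ v R x m := by
  classical
  induction m using Finsupp.induction_linear with
  | zero => simp
  | add m n hm hn => rw [map_add, map_add, hm, hn]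
  | single l c =>
    rw [act_single, map_smul]
    congr 1
    cases l with
    | nil => rw [actBasis, proj_bas]; simp [start]
    | cons y l =>
      rw [actBasis, map_add, proj_bas]
      simp only [start, if_true]
      congr 1
      split_ifs with h
      swap
      · simp
      obtain ⟨hn, -, hr⟩ := h
      have hst := hn.rng_eq
      cases x with
      | edge α i =>
        cases y with
        | edge => simp [red]
        | ghost β j =>
          simp only [red]
          split_ifs with hc hij
          · obtain ⟨rfl, hc⟩ := hc
            rw [map_sub, proj_bas, if_pos (show E.start v l = E.src (.edge α i) from hst.symm), map_sum]
            congr 1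
            refine Finset.sum_congr rfl fun γ hγ => ?_
            rw [Finset.mem_erase, mem_out] at hγ
            rw [proj_bas]
            exact if_pos hγ.2
          · rw [map_sub, map_zero, map_sum]
            congr 1
            refine Finset.sum_congr rfl fun γ hγ => ?_
            rw [Finset.mem_erase, mem_out] at hγ
            rw [proj_bas]
            exact if_pos hγ.2
          · simp
      | ghost α i =>
        cases y with
        | ghost => simp [red]
        | edge β j =>
          simp only [red]
          split_ifs with hc hij
          · subst hij
            rw [map_sub, proj_bas, if_pos (show E.start v l = E.src (.ghost α i) from hst.symm), map_sum]
            congr 1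
            refine Finset.sum_congr rfl fun γ hγ => ?_
            rw [proj_bas]
            exact if_pos rfl
          · rw [map_sub, map_zero, map_sum]
            congr 1
            refine Finset.sum_congr rfl fun γ hγ => ?_
            rw [proj_bas]
            exact if_pos rfl
          · simp

theorem act_proj_rng (x : Letter S) (m : List (Letter S) →₀ R) :
    E.act σ v R x (E.proj σ v R (E.rng x) m) = E.act σ v R x m := by
  classical
  induction m using Finsupp.induction_linear with
  | zero => simp
  | add m n hm hn => rw [map_add, map_add, map_add, hm, hn]
  | single l c =>
    have : Finsupp.single l c = c • Finsupp.single l (1 : R) := by simp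
    simp only [this, map_smul, proj_single_one, proj_bas, act_single_one]
    split_ifs with h
    · rfl
    · rw [act_bas_of_rng_ne (Ne.symm h), map_zero]

theorem rep_eq_of_rel (hσ : E.IsSpecial σ) {a b : E.FreeRRing R} (h : E.Rel R a b) :
    E.rep σ v R a = E.rep σ v R b := by
  classical
  cases h with
  | vertex_mul u w =>
    ext1 m
    rw [rep_mul, rep_vtx, rep_vtx, proj_proj]
    split_ifs
    · rw [rep_vtx]
    · rw [rep_zero]
  | source_mul_edge α i hi =>
    ext1 m
    rw [rep_mul, rep_vtx, rep_edg]
    exact proj_src_act (.edge α i) m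
  | edge_mul_range α i hi =>
    ext1 m
    rw [rep_mul, rep_vtx, rep_edg, rep_edg]
    exact act_proj_rng (.edge α i) m
  | range_mul_ghost α i hi =>
    ext1 m
    rw [rep_mul, rep_vtx, rep_gho]
    exact proj_src_act (.ghost α i) m
  | ghost_mul_source α i hi =>
    ext1 m
    rw [rep_mul, rep_vtx, rep_gho, rep_gho]
    exact act_proj_rng (.ghost α i) m
  | sum_edge_ghost u i j hi hj =>
    refine ext_single (fun l => ?_) (fun c m => ?_) (fun c m => ?_)
    · simp only [rep_sum, rep_mul, rep_edg, rep_gho, act_single_one]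
      rw [sum_act_edge_act_ghost hσ u l hi hj]
      split_ifs
      · rw [rep_vtx, proj_single_one]
      · rw [rep_zero]
    · simp only [rep_sum, rep_mul, rep_edg, rep_gho, map_smul, Finset.smul_sum]
    · split_ifs
      · simp only [rep_vtx, map_smul]
      · simp only [rep_zero, smul_zero]
  | sum_ghost_edge α β =>
    refine ext_single (fun l => ?_) (fun c m => ?_) (fun c m => ?_)
    · simp only [rep_sum, rep_mul, rep_edg, rep_gho, act_single_one]
      rw [sum_act_ghost_act_edge hσ α β l (le_max_right _ _)]
      split_ifs
      · rw [rep_vtx, proj_single_one]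
      · rw [rep_zero]
    · simp only [rep_sum, rep_mul, rep_edg, rep_gho, map_smul, Finset.smul_sum]
    · split_ifs
      · simp only [rep_vtx, map_smul]
      · simp only [rep_zero, smul_zero]

/-- The kernel is one of the ideals whose intersection defines the ideal of relations. -/
theorem relIdeal_le_ker (hσ : E.IsSpecial σ) : E.relIdeal R ≤ TwoSidedIdeal.ker (E.rep σ v R) := by
  refine sInf_le ⟨fun a b h => ?_, fun c a ha => ?_⟩
  · rw [TwoSidedIdeal.mem_ker, map_sub, rep_eq_of_rel hσ h, sub_self]
  · rw [TwoSidedIdeal.mem_ker] at ha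
    constructor
    · rw [TwoSidedIdeal.mem_ker]
      ext1 m
      rw [rep_smul, ha]
      exact smul_zero c
    · rw [TwoSidedIdeal.mem_ker]
      ext1 m
      rw [rep_op_smul, ha]
      rfl

variable (E R) in
/-- The canonical map from `R⟨X⟩` onto the weighted Leavitt path algebra. -/
def toL : E.FreeRRing R →ₙ+* E.LeavittPathAlgebra R where
  toFun f := (f : (E.relIdeal R).ringCon.Quotient)
  map_zero' := rfl
  map_add' _ _ := rfl
  map_mul' _ _ := rfl

theorem toL_surjective : Function.Surjective (E.toL R) := Quotient.mk_surjective

theorem toL_eq_iff {f g : E.FreeRRing R} : E.toL R f = E.toL R g ↔ f - g ∈ E.relIdeal R := by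
  rw [← TwoSidedIdeal.rel_iff]
  exact RingCon.eq _

theorem rep_eq_of_toL_eq (hσ : E.IsSpecial σ) {f g : E.FreeRRing R}
    (h : E.toL R f = E.toL R g) : E.rep σ v R f = E.rep σ v R g := by
  have := relIdeal_le_ker (v := v) hσ (toL_eq_iff.1 h)
  rwa [TwoSidedIdeal.mem_ker, map_sub, sub_eq_zero] at this

theorem toL_eq_of_rel {f g : E.FreeRRing R} (h : E.Rel R f g) : E.toL R f = E.toL R g := by
  rw [toL_eq_iff, relIdeal, TwoSidedIdeal.mem_sInf]
  exact fun I hI => hI.1 _ _ h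

theorem toL_smul_congr (c : R) {f g : E.FreeRRing R} (h : E.toL R f = E.toL R g) :
    E.toL R (c • f) = E.toL R (c • g) := by
  rw [toL_eq_iff] at h ⊢
  rw [← smul_sub, relIdeal, TwoSidedIdeal.mem_sInf]
  rw [relIdeal, TwoSidedIdeal.mem_sInf] at h
  exact fun I hI => (hI.2 c _ (h I hI)).1

/-! ### Evaluating normal words in the algebra -/

variable (E R) in
/-- A letter as an element of `R⟨X⟩`, which is zero if the index is out of range. -/
def letterElt : Letter S → E.FreeRRing R
  | .edge α i => E.edg R α i
  | .ghost α i => E.gho R α i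

variable (E v R) in
/-- A word ending in `v` as an element of `R⟨X⟩`. -/
def wordElt : List (Letter S) → E.FreeRRing R
  | [] => E.vtx R v
  | x :: l => E.letterElt R x * wordElt l

variable (E σ v R) in
open Classical in
/-- The map that evaluates linear combinations of normal words in `R⟨X⟩`. -/
def evalWords : (List (Letter S) →₀ R) →ₗ[R] E.FreeRRing R :=
  Finsupp.linearCombination R fun l => if E.Nod σ v l then E.wordElt v R l else 0

theorem letterElt_of_not_valid {x : Letter S} (h : ¬ E.Valid x) : E.letterElt R x = 0 := by
  cases x <;> exact dif_neg h

theorem toL_vtx_mul_vtx_of_ne {u w : V} (h : u ≠ w) : E.toL R (E.vtx R u * E.vtx R w) = 0 := by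
  classical
  rw [toL_eq_of_rel (.vertex_mul u w), if_neg h, map_zero]

theorem toL_vtx_mul_self (u : V) : E.toL R (E.vtx R u * E.vtx R u) = E.toL R (E.vtx R u) := by
  classical
  rw [toL_eq_of_rel (.vertex_mul u u), if_pos rfl]

theorem toL_vtx_src_mul (x : Letter S) :
    E.toL R (E.vtx R (E.src x) * E.letterElt R x) = E.toL R (E.letterElt R x) := by
  by_cases h : E.Valid x
  · cases x with
    | edge α i => exact toL_eq_of_rel (.source_mul_edge α i h)
    | ghost α i => exact toL_eq_of_rel (.range_mul_ghost α i h)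
  · rw [letterElt_of_not_valid h, mul_zero]

theorem toL_mul_vtx_rng (x : Letter S) :
    E.toL R (E.letterElt R x * E.vtx R (E.rng x)) = E.toL R (E.letterElt R x) := by
  by_cases h : E.Valid x
  · cases x with
    | edge α i => exact toL_eq_of_rel (.edge_mul_range α i h)
    | ghost α i => exact toL_eq_of_rel (.ghost_mul_source α i h)
  · rw [letterElt_of_not_valid h, zero_mul]

theorem toL_vtx_start_mul (l : List (Letter S)) :
    E.toL R (E.vtx R (E.start v l) * E.wordElt v R l) = E.toL R (E.wordElt v R l) := by
  cases l with
  | nil => exact toL_vtx_mul_self v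
  | cons x l =>
    rw [wordElt, ← mul_assoc, map_mul, start, toL_vtx_src_mul, ← map_mul]

/-- The two distinct, hence orthogonal, vertices can be inserted between the factors. -/
theorem toL_letterElt_mul_of_rng_ne {x : Letter S} {l : List (Letter S)}
    (h : E.rng x ≠ E.start v l) : E.toL R (E.letterElt R x * E.wordElt v R l) = 0 := by
  rw [map_mul, ← toL_mul_vtx_rng, ← toL_vtx_start_mul, ← map_mul, mul_assoc,
    ← mul_assoc (E.vtx R _), map_mul, map_mul, toL_vtx_mul_vtx_of_ne h, zero_mul, mul_zero]

theorem evalWords_bas_of_nod {l : List (Letter S)} (h : E.Nod σ v l) :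
    E.evalWords σ v R (E.bas σ v R l) = E.wordElt v R l := by
  rw [bas_of_nod h, evalWords, Finsupp.linearCombination_single, one_smul, if_pos h]

theorem evalWords_single (l : List (Letter S)) (c : R) :
    E.evalWords σ v R (Finsupp.single l c) = c • E.evalWords σ v R (E.bas σ v R l) := by
  by_cases h : E.Nod σ v l
  · rw [evalWords_bas_of_nod h, evalWords, Finsupp.linearCombination_single, if_pos h]
  · rw [bas_of_not_nod h, evalWords, Finsupp.linearCombination_single, if_neg h, map_zero]

theorem toL_evalWords_cons {x : Letter S} {l : List (Letter S)} (hb : ¬ E.BadHead σ x l) :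
    E.toL R (E.evalWords σ v R (E.bas σ v R (x :: l))) =
      E.toL R (E.letterElt R x * E.evalWords σ v R (E.bas σ v R l)) := by
  by_cases hn : E.Nod σ v l
  swap
  · rw [bas_of_not_nod hn, bas_of_not_nod fun h => hn h.tail, map_zero, mul_zero]
  by_cases hx : E.Valid x
  swap
  · rw [letterElt_of_not_valid hx, bas_of_not_nod fun h => hx h.valid, map_zero, zero_mul]
  by_cases hr : E.rng x = E.start v l
  · rw [evalWords_bas_of_nod (nod_cons.2 ⟨hx, hr, hb, hn⟩), evalWords_bas_of_nod hn, wordElt]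
  · rw [evalWords_bas_of_nod hn, toL_letterElt_mul_of_rng_ne hr,
      bas_of_not_nod fun h => hr h.rng_eq, map_zero, map_zero]

-- Relation (3) solved for its special term. Maximality of `ω(α)` makes the relation available for
-- all indices of `α`.
open Classical in
theorem toL_edg_mul_gho_special (hσ : E.IsSpecial σ) {α : S} (hα : σ (E.s α) = α) {i j : ℕ}
    (hi : i < E.ω α) (hj : j < E.ω α) :
    E.toL R (E.edg R α i) * E.toL R (E.gho R α j) =
      (if i = j then E.toL R (E.vtx R (E.s α)) else 0) -
        ∑ γ ∈ (E.out (E.s α)).erase α, E.toL R (E.edg R γ i) * E.toL R (E.gho R γ j) := by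
  have hw := hσ.weight α
  rw [hα] at hw
  have h := toL_eq_of_rel (Rel.sum_edge_ghost (E := E) (R := R) (E.s α) i j (hw ▸ hi) (hw ▸ hj))
  rw [map_sum, ← Finset.add_sum_erase _ _ (mem_out.2 rfl : α ∈ E.out (E.s α))] at h
  simp only [map_mul] at h
  rw [eq_sub_iff_add_eq, h]
  split_ifs <;> simp

-- Relation (4) solved for its term of index `0`; terms with `k ≥ ω(β)` are zero.
open Classical in
theorem toL_gho_mul_edg_zero (α β : S) :
    E.toL R (E.gho R α 0) * E.toL R (E.edg R β 0) =
      (if α = β then E.toL R (E.vtx R (E.r α)) else 0) -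
        ∑ k ∈ Finset.Ico 1 (E.ω β), E.toL R (E.gho R α k) * E.toL R (E.edg R β k) := by
  have h := toL_eq_of_rel (Rel.sum_ghost_edge (E := E) (R := R) α β)
  have hβ := E.ω_pos β
  rw [map_sum, Finset.range_eq_Ico, Finset.sum_eq_sum_Ico_succ_bot (by omega),
    ← Finset.sum_subset (Finset.Ico_subset_Ico_right (le_max_right (E.ω α) (E.ω β)))] at h
  · simp only [map_mul] at h
    rw [eq_sub_iff_add_eq, h]
    split_ifs <;> simp
  · intro k hk hk'
    have : ¬ k < E.ω β := by
      simp at hk hk'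
      omega
    rw [edg, dif_neg this, mul_zero, map_zero]

/-- The action was defined by the very rewriting rules that the two solved relations express. -/
theorem toL_letterElt_mul_evalWords_bas (hσ : E.IsSpecial σ) (x : Letter S)
    (l : List (Letter S)) :
    E.toL R (E.letterElt R x * E.evalWords σ v R (E.bas σ v R l)) =
      E.toL R (E.evalWords σ v R (E.act σ v R x (E.bas σ v R l))) := by
  classical
  by_cases hb : E.BadHead σ x l
  swap
  · rw [act_bas_of_not_badHead hb, toL_evalWords_cons hb]
  by_cases hn : E.Nod σ v l
  swap
  · rw [bas_of_not_nod hn, map_zero, map_zero, mul_zero, map_zero, map_zero, map_zero]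
  by_cases hx : E.Valid x
  swap
  · rw [letterElt_of_not_valid hx, act_bas_of_not_valid hx, map_zero, zero_mul]
  by_cases hr : E.rng x = E.start v l
  swap
  · rw [evalWords_bas_of_nod hn, toL_letterElt_mul_of_rng_ne hr, act_bas_of_rng_ne hr, map_zero,
      map_zero]
  cases l with
  | nil => exact hb.elim
  | cons y l =>
  have hst := toL_vtx_start_mul (E := E) (R := R) (v := v) l
  rw [← hn.rng_eq, map_mul] at hst
  rw [evalWords_bas_of_nod hn, wordElt, map_mul, map_mul, ← mul_assoc]
  cases x with
  | edge α i =>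
    cases y with
    | edge => exact hb.elim
    | ghost β j =>
    obtain ⟨rfl, hα⟩ : α = β ∧ _ := hb
    change E.toL R (E.edg R α i) * E.toL R (E.gho R α j) * _ = _
    rw [act_edge_bas_ghost hx hα hn, toL_edg_mul_gho_special hσ hα hx hn.valid, sub_mul, map_sub,
      map_sub, map_sum, map_sum, Finset.sum_mul]
    congr 1
    · split_ifs
      · rw [evalWords_bas_of_nod hn.tail]; exact hst
      · rw [zero_mul, map_zero, map_zero]
    · refine Finset.sum_congr rfl fun γ hγ => ?_
      rw [Finset.mem_erase, mem_out] at hγ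
      rw [toL_evalWords_cons, map_mul, toL_evalWords_cons, map_mul, evalWords_bas_of_nod hn.tail,
        mul_assoc]
      · rfl
      · intro h
        refine (nod_cons.1 hn).2.2.1 ?_
        cases l with
        | nil => exact h
        | cons y l => cases y <;> exact h
      · rintro ⟨-, h⟩
        rw [hγ.2, hα] at h
        exact hγ.1 h.symm
  | ghost α i =>
    cases y with
    | ghost => exact hb.elim
    | edge β j =>
    obtain ⟨rfl, rfl⟩ : i = 0 ∧ j = 0 := hb
    change E.toL R (E.gho R α 0) * E.toL R (E.edg R β 0) * _ = _
    rw [act_ghost_bas_edge hr hn, toL_gho_mul_edg_zero, sub_mul, map_sub,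
      map_sub, map_sum, map_sum, Finset.sum_mul]
    congr 1
    · split_ifs with h
      · subst h; rw [evalWords_bas_of_nod hn.tail]; exact hst
      · rw [zero_mul, map_zero, map_zero]
    · refine Finset.sum_congr rfl fun k hk => ?_
      rw [toL_evalWords_cons, map_mul, toL_evalWords_cons, map_mul, evalWords_bas_of_nod hn.tail,
        mul_assoc]
      · rfl
      · intro h
        refine (nod_cons.1 hn).2.2.1 ?_
        cases l with
        | nil => exact h
        | cons y l => cases y <;> exact h
      · rintro ⟨h, -⟩
        simp [h] at hk

theorem ι_mul_smul (x : E.Gen) (c : R) (g : E.FreeRRing R) :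
    E.ι R x * (c • g) = c • (E.ι R x * g) := by
  induction g using MonoidAlgebra.induction_linear with
  | zero => simp
  | add f g hf hg => rw [smul_add, mul_add, hf, hg, mul_add, smul_add]
  | single w r => simp [ι]

theorem toL_ι_mul_evalWords (hσ : E.IsSpecial σ) (x : E.Gen) (m : List (Letter S) →₀ R) :
    E.toL R (E.ι R x * E.evalWords σ v R m) =
      E.toL R (E.evalWords σ v R (E.genAct σ v R x m)) := by
  classical
  induction m using Finsupp.induction_linear with
  | zero => simp
  | add m n hm hn => simp only [map_add, mul_add, hm, hn]
  | single l c =>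
    have h1 : E.genAct σ v R x (Finsupp.single l c) = c • E.genAct σ v R x (E.bas σ v R l) := by
      have : Finsupp.single l c = c • Finsupp.single l (1 : R) := by simp
      rw [this, map_smul]
      cases x <;> simp only [genAct, act_single_one, proj_single_one]
    rw [h1, evalWords_single, ι_mul_smul, (E.evalWords σ v R).map_smul]
    refine toL_smul_congr c ?_
    cases x with
    | vertex u =>
      by_cases hn : E.Nod σ v l
      swap
      · simp [bas_of_not_nod hn]
      change E.toL R (E.vtx R u * _) = E.toL R (E.evalWords σ v R (E.proj σ v R u _))
      rw [proj_bas]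
      split_ifs with h
      · subst h
        rw [evalWords_bas_of_nod hn, toL_vtx_start_mul]
      · rw [evalWords_bas_of_nod hn, map_mul, ← toL_vtx_start_mul, ← map_mul, ← mul_assoc, map_mul,
          toL_vtx_mul_vtx_of_ne (Ne.symm h), zero_mul, map_zero, map_zero]
    | edge α i =>
      have h := toL_letterElt_mul_evalWords_bas (v := v) (R := R) hσ (.edge α i) l
      rwa [letterElt, edg, dif_pos i.2] at h
    | ghost α i =>
      have h := toL_letterElt_mul_evalWords_bas (v := v) (R := R) hσ (.ghost α i) l
      rwa [letterElt, gho, dif_pos i.2] at h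

/-- Applied to the empty word, this expresses `f v` in `L` through normal words, with coefficients
read off from the action of `f`. -/
theorem toL_mul_evalWords (hσ : E.IsSpecial σ) (f : E.FreeRRing R) (m : List (Letter S) →₀ R) :
    E.toL R (f * E.evalWords σ v R m) = E.toL R (E.evalWords σ v R (E.rep σ v R f m)) := by
  induction f using MonoidAlgebra.induction_linear with
  | zero => simp
  | add f g hf hg => rw [add_mul, map_add, hf, hg, rep_add, map_add, map_add]
  | single w c =>
    have h1 : MonoidAlgebra.single w c = c • (MonoidAlgebra.single w 1 : E.FreeRRing R) := by
      simp
    rw [h1, smul_mul_assoc, rep_smul, (E.evalWords σ v R).map_smul]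
    refine toL_smul_congr c ?_
    clear h1
    induction w generalizing m with
    | ih1 x =>
      change E.toL R (E.ι R x * _) = E.toL R (E.evalWords σ v R (E.rep σ v R (E.ι R x) m))
      rw [rep_ι, toL_ι_mul_evalWords hσ]
    | ih2 x w hx hw =>
      have : (MonoidAlgebra.single (FreeSemigroup.of x * w) 1 : E.FreeRRing R) =
          MonoidAlgebra.single (FreeSemigroup.of x) 1 * MonoidAlgebra.single w 1 := by simp
      rw [this, mul_assoc, map_mul, hw, ← map_mul, hx, rep_mul]

/-! ### Local units -/

theorem exists_toL_mul_vtx (w : FreeSemigroup E.Gen) :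
    ∃ u, E.toL R (MonoidAlgebra.single w 1 * E.vtx R u) =
      E.toL R (MonoidAlgebra.single w 1) := by
  induction w with
  | ih1 x =>
    cases x with
    | vertex u => exact ⟨u, toL_vtx_mul_self u⟩
    | edge α i =>
      refine ⟨E.r α, ?_⟩
      have h := toL_mul_vtx_rng (E := E) (R := R) (.edge α i)
      rwa [letterElt, edg, dif_pos i.2] at h
    | ghost α i =>
      refine ⟨E.s α, ?_⟩
      have h := toL_mul_vtx_rng (E := E) (R := R) (.ghost α i)
      rwa [letterElt, gho, dif_pos i.2] at h
  | ih2 x w _ hw =>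
    obtain ⟨u, hu⟩ := hw
    refine ⟨u, ?_⟩
    have : (MonoidAlgebra.single (FreeSemigroup.of x * w) 1 : E.FreeRRing R) =
        MonoidAlgebra.single (FreeSemigroup.of x) 1 * MonoidAlgebra.single w 1 := by simp
    rw [this, mul_assoc, map_mul, hu, map_mul]

/-- Each monomial is fixed on the right by one vertex and vertices are orthogonal, so any finite sum
containing the needed ones is a right unit for `f`. -/
theorem exists_finset_toL_mul_sum_vtx (f : E.FreeRRing R) :
    ∃ T : Finset V, ∀ T', T ⊆ T' → E.toL R (f * ∑ u ∈ T', E.vtx R u) = E.toL R f := by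
  classical
  induction f using MonoidAlgebra.induction_linear with
  | zero => exact ⟨∅, fun T' _ => by rw [zero_mul]⟩
  | add f g hf hg =>
    obtain ⟨T₁, h₁⟩ := hf
    obtain ⟨T₂, h₂⟩ := hg
    refine ⟨T₁ ∪ T₂, fun T' hT' => ?_⟩
    rw [add_mul, map_add, map_add, h₁ _ (Finset.union_subset_left hT'),
      h₂ _ (Finset.union_subset_right hT')]
  | single w c =>
    obtain ⟨u, hu⟩ := exists_toL_mul_vtx (E := E) (R := R) w
    refine ⟨{u}, fun T' hT' => ?_⟩
    have h1 : MonoidAlgebra.single w c = c • (MonoidAlgebra.single w 1 : E.FreeRRing R) := by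
      simp
    rw [h1, smul_mul_assoc]
    refine toL_smul_congr c ?_
    rw [map_mul, ← hu, ← map_mul, mul_assoc, Finset.mul_sum, map_mul, map_sum, map_mul,
      Finset.sum_eq_single u]
    · rw [toL_vtx_mul_self]
    · intro w _ hw
      exact toL_vtx_mul_vtx_of_ne hw.symm
    · intro h
      exact absurd (hT' (Finset.mem_singleton_self u)) h

theorem exists_toL_mul_vtx_ne_zero {f : E.FreeRRing R} (hf : E.toL R f ≠ 0) :
    ∃ u, E.toL R (f * E.vtx R u) ≠ 0 := by
  by_contra! h
  obtain ⟨T, hT⟩ := exists_finset_toL_mul_sum_vtx f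
  refine hf ?_
  rw [← hT T subset_rfl, Finset.mul_sum, map_sum]
  exact Finset.sum_eq_zero fun u _ => h u

/-! ### The image of the action lies in the span of the normal words -/

theorem bas_mem_supported (l : List (Letter S)) :
    E.bas σ v R l ∈ Finsupp.supported R R {l | E.Nod σ v l} := by
  by_cases h : E.Nod σ v l
  · rw [bas_of_nod h]
    exact Finsupp.single_mem_supported R 1 h
  · rw [bas_of_not_nod h]
    exact zero_mem _

theorem red_mem_supported (x y : Letter S) (l : List (Letter S)) :
    E.red σ v R x y l ∈ Finsupp.supported R R {l | E.Nod σ v l} := by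
  classical
  cases x <;> cases y <;> simp only [red] <;> try split_ifs
  all_goals
    first
    | exact zero_mem _
    | exact sub_mem (bas_mem_supported _) (sum_mem fun _ _ => bas_mem_supported _)
    | exact sub_mem (zero_mem _) (sum_mem fun _ _ => bas_mem_supported _)

theorem genAct_mem_supported (x : E.Gen) (m : List (Letter S) →₀ R) :
    E.genAct σ v R x m ∈ Finsupp.supported R R {l | E.Nod σ v l} := by
  classical
  have hact : ∀ x l, E.act σ v R x (E.bas σ v R l) ∈
      Finsupp.supported R R {l | E.Nod σ v l} := by
    intro x l
    rw [act_bas]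
    cases l with
    | nil => exact bas_mem_supported _
    | cons y l =>
      refine add_mem (bas_mem_supported _) ?_
      split_ifs
      · exact red_mem_supported _ _ _
      · exact zero_mem _
  induction m using Finsupp.induction_linear with
  | zero => simp
  | add m n hm hn => rw [map_add]; exact add_mem hm hn
  | single l c =>
    have : Finsupp.single l c = c • Finsupp.single l (1 : R) := by simp
    rw [this, map_smul]
    refine Submodule.smul_mem _ _ ?_
    cases x with
    | vertex u =>
      rw [genAct, proj_single_one, proj_bas]
      split_ifs
      · exact bas_mem_supported _
      · exact zero_mem _
    | edge α i => rw [genAct, act_single_one]; exact hact _ _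
    | ghost α i => rw [genAct, act_single_one]; exact hact _ _

theorem rep_mem_supported (f : E.FreeRRing R) (m : List (Letter S) →₀ R) :
    E.rep σ v R f m ∈ Finsupp.supported R R {l | E.Nod σ v l} := by
  induction f using MonoidAlgebra.induction_linear with
  | zero => rw [rep_zero]; exact zero_mem _
  | add f g hf hg => rw [rep_add]; exact add_mem hf hg
  | single w c =>
    rw [rep_single]
    refine Submodule.smul_mem _ _ ?_
    induction w generalizing m with
    | ih1 x => exact genAct_mem_supported x m
    | ih2 x w hx hw => rw [monAct_mul]; exact hx _

theorem nod_of_rep_ne_zero {f : E.FreeRRing R} {m : List (Letter S) →₀ R} {l : List (Letter S)}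
    (h : E.rep σ v R f m l ≠ 0) : E.Nod σ v l :=
  (Finsupp.mem_supported R _).1 (rep_mem_supported f m) (Finsupp.mem_support_iff.2 h)

end

end WeightedGraph

/-! ### Combinatorics of the rewriting rules -/

namespace WeightedGraph

variable {V S : Type*} {E : WeightedGraph V S} {σ : V → S} {u v : V}

variable (E σ) in
/-- `Red x y z w`: the word `z w` occurs with coefficient `-1` in the normal form of the forbidden
word `x y`. -/
inductive Red : Letter S → Letter S → Letter S → Letter S → Prop
  | edge {α γ : S} {i j : ℕ} (hα : σ (E.s α) = α) (hγ : γ ≠ α) (hs : E.s γ = E.s α) :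
      Red (.edge α i) (.ghost α j) (.edge γ i) (.ghost γ j)
  | ghost {α β : S} {k : ℕ} (h1 : 1 ≤ k) (h2 : k < E.ω β) :
      Red (.ghost α 0) (.edge β 0) (.ghost α k) (.edge β k)

theorem Red.bad {x y z w : Letter S} (h : E.Red σ x y z w) : E.Bad σ x y := by
  cases h with
  | edge hα => exact ⟨rfl, hα⟩
  | ghost => exact ⟨rfl, rfl⟩

theorem Red.src_eq {x y z w : Letter S} (h : E.Red σ x y z w) : E.src z = E.src x := by
  cases h with
  | edge _ _ hs => exact hs
  | ghost => rfl

theorem Red.bad_left {x y z w a : Letter S} (h : E.Red σ x y z w) (ha : E.Bad σ a z) :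
    E.Bad σ a x := by
  cases h <;> cases a <;> exact ha

theorem Red.not_bad {x y z w : Letter S} (h : E.Red σ x y z w) : ¬ E.Bad σ z y := by
  cases h with
  | edge _ hγ => exact fun h => hγ h.1
  | ghost h1 => exact fun h => by have := h.1; omega

/-- A replacement pair repeats its edge (`γᵢ γⱼ*`) or its index (`αₖ* βₖ`). The mixed pair `z y` is
`γᵢ αⱼ*` with `γ ≠ α`, or `αₖ* β₀` with `k ≥ 1`, and does neither. -/
theorem Red.not_red {x y z w x' y' : Letter S} (h : E.Red σ x y z w) : ¬ E.Red σ x' y' z y := by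
  cases h with
  | edge _ hγ => intro h; cases h; exact hγ rfl
  | ghost h1 => intro h; cases h; omega

/-- The special edge is determined by the common source, and in the other rule only the index
changes, from `0`. -/
theorem Red.unique {x y x' y' z w : Letter S} (h : E.Red σ x y z w) (h' : E.Red σ x' y' z w) :
    x = x' ∧ y = y' := by
  cases h with
  | edge hα _ hs =>
    cases h' with
    | edge hα' _ hs' =>
      rw [← hs] at hα
      rw [← hs', hα] at hα'
      subst hα'
      exact ⟨rfl, rfl⟩
  | ghost => cases h'; exact ⟨rfl, rfl⟩

noncomputable section

variable {R : Type*} [Ring R]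

/-- Puts both rules in one shape. The scalar `c` is left unspecified since the shorter word never
affects top-length coefficients. -/
theorem exists_red_eq {x y : Letter S} (hb : E.Bad σ x y) (l : List (Letter S)) :
    ∃ (c : R) (T : Finset (Letter S × Letter S)), (∀ z w, (z, w) ∈ T ↔ E.Red σ x y z w) ∧
      E.red σ v R x y l =
        c • E.bas σ v R l - ∑ a ∈ T, E.bas σ v R (a.1 :: a.2 :: l) := by
  classical
  cases x with
  | edge α i =>
    cases y with
    | edge => exact hb.elim
    | ghost β j =>
    obtain ⟨rfl, hα⟩ : α = β ∧ _ := hb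
    refine ⟨if i = j then 1 else 0, ((E.out (E.s α)).erase α).image
      fun γ => (.edge γ i, .ghost γ j), fun z w => ?_, ?_⟩
    · simp only [Finset.mem_image, Finset.mem_erase, mem_out, Prod.mk.injEq]
      constructor
      · rintro ⟨γ, ⟨h1, h2⟩, rfl, rfl⟩
        exact .edge hα h1 h2
      · intro h
        cases h with
        | edge _ hγ hs => exact ⟨_, ⟨hγ, hs⟩, rfl, rfl⟩
    · rw [Finset.sum_image]
      · simp [red, hα]
      · intro a _ b _ hab
        simpa using hab
  | ghost α i =>
    cases y with
    | ghost => exact hb.elim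
    | edge β j =>
    obtain ⟨rfl, rfl⟩ : i = 0 ∧ j = 0 := hb
    refine ⟨if α = β then 1 else 0, (Finset.Ico 1 (E.ω β)).image
      fun k => (.ghost α k, .edge β k), fun z w => ?_, ?_⟩
    · simp only [Finset.mem_image, Finset.mem_Ico, Prod.mk.injEq]
      constructor
      · rintro ⟨γ, ⟨h1, h2⟩, rfl, rfl⟩
        exact .ghost h1 h2
      · intro h
        cases h with
        | ghost h1 h2 => exact ⟨_, ⟨h1, h2⟩, rfl, rfl⟩
    · rw [Finset.sum_image]
      · simp [red]
      · intro a _ b _ hab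
        simpa using hab

/-! ### Leading terms of products -/

variable (E σ v R) in
/-- The action of a word, letter by letter. -/
def actWord : List (Letter S) → (List (Letter S) →₀ R) →ₗ[R] (List (Letter S) →₀ R)
  | [] => LinearMap.id
  | x :: p => E.act σ v R x ∘ₗ actWord p

theorem actWord_append (p p' : List (Letter S)) (m : List (Letter S) →₀ R) :
    E.actWord σ v R (p ++ p') m = E.actWord σ v R p (E.actWord σ v R p' m) := by
  induction p with
  | nil => rfl
  | cons x p ih => simp [actWord, ih]

theorem actWord_bas {p l : List (Letter S)} (h : E.Nod σ v (p ++ l)) :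
    E.actWord σ v R p (E.bas σ v R l) = E.bas σ v R (p ++ l) := by
  induction p with
  | nil => rfl
  | cons x p ih =>
    rw [actWord, LinearMap.comp_apply, ih h.tail,
      act_bas_of_not_badHead (nod_cons (l := p ++ l) |>.1 h).2.2.1, List.cons_append]

theorem bas_mem_length {l : List (Letter S)} {k : ℕ} (h : l.length ≤ k) :
    E.bas σ v R l ∈ Finsupp.supported R R {l : List (Letter S) | l.length ≤ k} := by
  by_cases hn : E.Nod σ v l
  · rw [bas_of_nod hn]
    exact Finsupp.single_mem_supported R 1 h
  · rw [bas_of_not_nod hn]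
    exact zero_mem _

theorem act_mem_length (x : Letter S) {m : List (Letter S) →₀ R} {k : ℕ}
    (h : m ∈ Finsupp.supported R R {l : List (Letter S) | l.length ≤ k}) :
    E.act σ v R x m ∈ Finsupp.supported R R {l : List (Letter S) | l.length ≤ k + 1} := by
  classical
  rw [act, Finsupp.linearCombination_apply, Finsupp.sum]
  refine sum_mem fun l hl => Submodule.smul_mem _ _ ?_
  have hl : l.length ≤ k := (Finsupp.mem_supported R _).1 h hl
  cases l with
  | nil => exact bas_mem_length (by simp)
  | cons y l =>
    refine add_mem (bas_mem_length (by simpa using hl)) ?_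
    split_ifs
    swap
    · exact zero_mem _
    rw [List.length_cons] at hl
    by_cases hb : E.Bad σ x y
    · obtain ⟨c, T, -, hT⟩ := exists_red_eq (v := v) (R := R) hb l
      rw [hT]
      refine sub_mem (Submodule.smul_mem _ _ (bas_mem_length (by omega)))
        (sum_mem fun a _ => bas_mem_length ?_)
      simp only [List.length_cons]
      omega
    · rw [red_of_not_bad hb]
      exact zero_mem _

theorem actWord_mem_length (p : List (Letter S)) {m : List (Letter S) →₀ R} {k : ℕ}
    (h : m ∈ Finsupp.supported R R {l : List (Letter S) | l.length ≤ k}) :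
    E.actWord σ v R p m ∈
      Finsupp.supported R R {l : List (Letter S) | l.length ≤ k + p.length} := by
  induction p with
  | nil => exact h
  | cons x p ih => exact act_mem_length x ih

theorem actWord_bas_apply_eq_zero {p q t : List (Letter S)} (h : p.length + q.length < t.length) :
    E.actWord σ v R p (E.bas σ v R q) t = 0 := by
  by_contra h'
  have := (Finsupp.mem_supported R _).1
    (actWord_mem_length (E := E) (σ := σ) (v := v) (R := R) p (bas_mem_length (le_refl q.length)))
    (Finsupp.mem_support_iff.2 h')
  change t.length ≤ _ at this
  omega

theorem bas_apply [DecidableEq (List (Letter S))] {l t : List (Letter S)} (ht : E.Nod σ v t) :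
    E.bas σ v R l t = if l = t then 1 else 0 := by
  by_cases h : l = t
  · subst h
    simp [bas_of_nod ht]
  · by_cases hn : E.Nod σ v l
    · simp [bas_of_nod hn, h]
    · simp [bas_of_not_nod hn, h]

theorem append_cons_cons_inj {p p' l l' : List (Letter S)} {x y x' y' : Letter S}
    (h : p.length = p'.length) :
    p ++ x :: y :: l = p' ++ x' :: y' :: l' ↔ p = p' ∧ x = x' ∧ y = y' ∧ l = l' := by
  constructor
  · intro h'
    obtain ⟨h1, h2⟩ := List.append_inj h' h
    simp at h2
    exact ⟨h1, h2⟩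
  · rintro ⟨rfl, rfl, rfl, rfl⟩
    rfl

open Classical in
/-- The coefficients of words of maximal length in the product of two normal words. -/
theorem actWord_bas_apply {p q p₀ q₀ : List (Letter S)} {z w : Letter S}
    (hp : E.Nod σ u p) (hq : E.Nod σ v q) (hu : E.start v q = u)
    (ht : E.Nod σ v (p₀ ++ z :: w :: q₀))
    (hpl : p.length ≤ p₀.length + 1) (hql : q.length ≤ q₀.length + 1) :
    E.actWord σ v R p (E.bas σ v R q) (p₀ ++ z :: w :: q₀) =
      if p = p₀ ++ [z] ∧ q = w :: q₀ then 1
      else if ∃ x y, p = p₀ ++ [x] ∧ q = y :: q₀ ∧ E.Red σ x y z w then -1 else 0 := by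
  by_cases hlen : p.length + q.length < (p₀ ++ z :: w :: q₀).length
  · rw [actWord_bas_apply_eq_zero hlen, if_neg, if_neg]
    · rintro ⟨x, y, rfl, rfl, -⟩
      simp at hlen
      omega
    · rintro ⟨rfl, rfl⟩
      simp at hlen
      omega
  -- The length bounds are now equalities: `p` and `q` are nonempty and meet exactly between `z` and
  -- `w`.
  simp only [List.length_append, List.length_cons] at hlen
  obtain rfl | ⟨p', x, rfl⟩ := List.eq_nil_or_concat p
  · simp at hlen; omega
  cases q with
  | nil => simp at hlen hpl; omega
  | cons y q' =>
  simp only [List.concat_eq_append] at *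
  simp only [List.length_append, List.length_cons, List.length_nil] at hlen hpl hql
  have hl1 : p'.length = p₀.length := by omega
  have hl2 : q'.length = q₀.length := by omega
  have hzw : ¬ E.Bad σ z w := (nod_cons.1 ht.suffix).2.2.1
  have hlast := hp.last
  have hr : E.rng x = E.src y := hlast.2.trans hu.symm
  have h1 : E.actWord σ v R (p' ++ [x]) (E.bas σ v R (y :: q')) =
      E.actWord σ v R p' (E.act σ v R x (E.bas σ v R (y :: q'))) := by
    rw [actWord_append]; rfl
  rw [h1]
  by_cases hb : E.Bad σ x y
  · obtain ⟨c, T, hT, hred⟩ := exists_red_eq (v := v) (R := R) hb q'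
    rw [act_bas_of_bad hlast.1 hb hq hr, hred, map_sub, map_smul, Finsupp.sub_apply,
      Finsupp.smul_apply, actWord_bas_apply_eq_zero, smul_zero, zero_sub, map_sum,
      Finsupp.finsetSum_apply]
    swap
    · simp; omega
    have h2 : ∀ a ∈ T, E.actWord σ v R p' (E.bas σ v R (a.1 :: a.2 :: q'))
        (p₀ ++ z :: w :: q₀) = if p' = p₀ ∧ a = (z, w) ∧ q' = q₀ then 1 else 0 := by
      rintro ⟨a, b⟩ hab
      rw [hT] at hab
      -- One rewriting suffices: the new first letter has the old source and forms no new forbidden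
      -- pair with the letter before it.
      have h3 : E.actWord σ v R p' (E.bas σ v R (a :: b :: q')) =
          E.bas σ v R (p' ++ a :: b :: q') := by
        by_cases hn : E.Nod σ v (a :: b :: q')
        · refine actWord_bas (Nod.append (u := E.rng a) ?_ hn)
          exact hp.replace_last hn.valid rfl hab.src_eq fun _ => hab.bad_left
        · rw [bas_of_not_nod hn, map_zero, bas_of_not_nod fun h => hn h.suffix]
      rw [h3, bas_apply ht]
      refine if_congr ((append_cons_cons_inj hl1).trans ?_) rfl rfl
      simp [and_assoc]
    rw [Finset.sum_congr rfl h2, if_neg]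
    swap
    · rintro ⟨h4, h5⟩
      have h4 := (List.append_inj' h4 rfl).2
      simp at h4 h5
      exact hzw (h4 ▸ h5.1 ▸ hb)
    by_cases h : p' = p₀ ∧ q' = q₀ ∧ E.Red σ x y z w
    · obtain ⟨rfl, rfl, h⟩ := h
      rw [if_pos ⟨x, y, rfl, rfl, h⟩, Finset.sum_eq_single (z, w)]
      · simp
      · rintro b - hb
        simp [hb]
      · intro h'
        exact absurd ((hT z w).2 h) h'
    · rw [if_neg, Finset.sum_eq_zero, neg_zero]
      · rintro ⟨a, b⟩ hab
        rw [if_neg]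
        rintro ⟨h5, h6, h7⟩
        rw [h6, hT] at hab
        exact h ⟨h5, h7, hab⟩
      · rintro ⟨x', y', h5, h6, h7⟩
        obtain ⟨h8, h9⟩ := List.append_inj' h5 rfl
        simp at h6 h9
        obtain ⟨rfl, rfl⟩ := h6
        subst h9
        exact h ⟨h8, rfl, h7⟩
  · have hn : E.Nod σ v (x :: y :: q') := nod_cons.2 ⟨hlast.1, hr, hb, hq⟩
    rw [act_bas_of_not_badHead (l := y :: q') hb, actWord_bas (hp.append hn), bas_apply ht]
    have h3 : ¬ ∃ x' y', p' ++ [x] = p₀ ++ [x'] ∧ y :: q' = y' :: q₀ ∧ E.Red σ x' y' z w := by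
      rintro ⟨x', y', h5, h6, h7⟩
      obtain ⟨h8, h9⟩ := List.append_inj' h5 rfl
      simp at h6 h9
      obtain ⟨rfl, rfl⟩ := h6
      subst h9
      exact hb h7.bad
    rw [if_neg h3]
    refine if_congr ((append_cons_cons_inj hl1).trans ?_) rfl rfl
    constructor
    · rintro ⟨rfl, rfl, rfl, rfl⟩
      exact ⟨rfl, rfl⟩
    · rintro ⟨h5, h6⟩
      obtain ⟨h8, h9⟩ := List.append_inj' h5 rfl
      simp at h6 h9
      exact ⟨h8, h9, h6⟩

variable (E σ v R) in
/-- The product of two linear combinations of words. -/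
def mulWords (n m : List (Letter S) →₀ R) : List (Letter S) →₀ R :=
  n.sum fun p c => c • E.actWord σ v R p m

theorem mulWords_apply {n m : List (Letter S) →₀ R} (hm : ∀ q, m q ≠ 0 → E.Nod σ v q)
    (t : List (Letter S)) :
    E.mulWords σ v R n m t =
      ∑ p ∈ n.support, ∑ q ∈ m.support, n p * (m q * E.actWord σ v R p (E.bas σ v R q) t) := by
  rw [mulWords, Finsupp.sum, Finsupp.finsetSum_apply]
  refine Finset.sum_congr rfl fun p _ => ?_
  have h : m = ∑ q ∈ m.support, m q • E.bas σ v R q := by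
    conv_lhs => rw [← Finsupp.sum_single m, Finsupp.sum]
    refine Finset.sum_congr rfl fun q hq => ?_
    rw [bas_of_nod (hm q (Finsupp.mem_support_iff.1 hq))]
    simp
  conv_lhs => rw [h]
  rw [map_sum, Finsupp.smul_apply, Finsupp.finsetSum_apply, Finset.smul_sum]
  refine Finset.sum_congr rfl fun q _ => ?_
  rw [map_smul]
  rfl

theorem sum_sum_ite {n m : List (Letter S) →₀ R} [DecidableEq (List (Letter S))]
    (p₀ q₀ : List (Letter S)) :
    ∑ p ∈ n.support, ∑ q ∈ m.support, n p * (m q * if p = p₀ ∧ q = q₀ then 1 else 0) =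
      n p₀ * m q₀ := by
  rw [Finset.sum_eq_single p₀]
  · rw [Finset.sum_eq_single q₀]
    · simp
    · intro q _ hq; simp [hq]
    · intro hq
      rw [Finsupp.notMem_support_iff.1 hq]; simp
  · intro p _ hp
    simp [hp]
  · intro hp
    rw [Finsupp.notMem_support_iff.1 hp]; simp

section Leading

variable {n m : List (Letter S) →₀ R} {p₀ q₀ : List (Letter S)}

theorem mulWords_apply_of_not_red
    (hn : ∀ p, n p ≠ 0 → E.Nod σ u p ∧ p.length ≤ p₀.length + 1)
    (hm : ∀ q, m q ≠ 0 → (E.Nod σ v q ∧ E.start v q = u) ∧ q.length ≤ q₀.length + 1)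
    {z w : Letter S} (ht : E.Nod σ v (p₀ ++ z :: w :: q₀))
    (h : ∀ x y, ¬ E.Red σ x y z w) :
    E.mulWords σ v R n m (p₀ ++ z :: w :: q₀) = n (p₀ ++ [z]) * m (w :: q₀) := by
  classical
  rw [mulWords_apply fun q hq => (hm q hq).1.1, ← sum_sum_ite]
  refine Finset.sum_congr rfl fun p hp => Finset.sum_congr rfl fun q hq => ?_
  have hp := hn p (Finsupp.mem_support_iff.1 hp)
  have hq := hm q (Finsupp.mem_support_iff.1 hq)
  rw [actWord_bas_apply hp.1 hq.1.1 hq.1.2 ht hp.2 hq.2]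
  congr 2
  refine if_congr Iff.rfl rfl (if_neg ?_)
  rintro ⟨x, y, -, -, h'⟩
  exact h x y h'

/-- Besides the cut between `z` and `w`, the pair `x y` contributes with sign `-1`, and by
`Red.unique` no other pair does. -/
theorem mulWords_apply_of_red
    (hn : ∀ p, n p ≠ 0 → E.Nod σ u p ∧ p.length ≤ p₀.length + 1)
    (hm : ∀ q, m q ≠ 0 → (E.Nod σ v q ∧ E.start v q = u) ∧ q.length ≤ q₀.length + 1)
    {x y z w : Letter S} (ht : E.Nod σ v (p₀ ++ z :: w :: q₀))
    (h : E.Red σ x y z w) :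
    E.mulWords σ v R n m (p₀ ++ z :: w :: q₀) =
      n (p₀ ++ [z]) * m (w :: q₀) - n (p₀ ++ [x]) * m (y :: q₀) := by
  classical
  rw [mulWords_apply fun q hq => (hm q hq).1.1, ← sum_sum_ite, ← sum_sum_ite,
    ← Finset.sum_sub_distrib]
  refine Finset.sum_congr rfl fun p hp => ?_
  rw [← Finset.sum_sub_distrib]
  refine Finset.sum_congr rfl fun q hq => ?_
  have hp := hn p (Finsupp.mem_support_iff.1 hp)
  have hq := hm q (Finsupp.mem_support_iff.1 hq)
  rw [actWord_bas_apply hp.1 hq.1.1 hq.1.2 ht hp.2 hq.2, ← mul_sub, ← mul_sub]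
  congr 2
  have h1 : (∃ x' y', p = p₀ ++ [x'] ∧ q = y' :: q₀ ∧ E.Red σ x' y' z w) ↔
      p = p₀ ++ [x] ∧ q = y :: q₀ := by
    constructor
    · rintro ⟨x', y', h1, h2, h3⟩
      obtain ⟨rfl, rfl⟩ := h.unique h3
      exact ⟨h1, h2⟩
    · rintro ⟨h1, h2⟩
      exact ⟨x, y, h1, h2, h⟩
  rw [if_congr h1 rfl rfl]
  split_ifs with h2 h3 h3
  -- Both cuts at once would give `x = z` and `y = w`, making `z w` forbidden inside a normal word.
  · exfalso
    have h4 := (List.append_inj' (h2.1.symm.trans h3.1) rfl).2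
    have h5 := h2.2.symm.trans h3.2
    simp at h4 h5
    refine (nod_cons.1 ht.suffix).2.2.1 ?_
    rw [h4, BadHead, h5]
    exact h.bad
  · simp
  · simp
  · simp

/-- Leading terms do not cancel completely in a product. -/
theorem exists_mulWords_apply_ne_zero [NoZeroDivisors R]
    (hn : ∀ p, n p ≠ 0 → E.Nod σ u p ∧ p.length ≤ p₀.length + 1)
    (hm : ∀ q, m q ≠ 0 → (E.Nod σ v q ∧ E.start v q = u) ∧ q.length ≤ q₀.length + 1)
    (hE : E.IsLVGraph) (hσ : E.IsSpecial σ)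
    {x y : Letter S} (hx : n (p₀ ++ [x]) ≠ 0) (hy : m (y :: q₀) ≠ 0) :
    ∃ t, t.length = p₀.length + q₀.length + 2 ∧ E.mulWords σ v R n m t ≠ 0 := by
  by_contra! h0
  have h0 : ∀ z w, E.mulWords σ v R n m (p₀ ++ z :: w :: q₀) = 0 := fun z w =>
    h0 _ (by simp; omega)
  have hnod : ∀ z w, n (p₀ ++ [z]) ≠ 0 → m (w :: q₀) ≠ 0 → ¬ E.Bad σ z w →
      E.Nod σ v (p₀ ++ z :: w :: q₀) := by
    intro z w hz hw hzw
    have h1 := (hn _ hz).1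
    have h2 := (hm _ hw).1
    exact h1.append (nod_cons.2 ⟨h1.last.1, h1.last.2.trans h2.2.symm, hzw, h2.1⟩)
  -- The mixed word `p₀ z y q₀` arises in only one way, so its coefficient is a product of two
  -- nonzero scalars.
  have hA : ∀ x y z w, E.Red σ x y z w → n (p₀ ++ [z]) ≠ 0 → m (y :: q₀) ≠ 0 → False := by
    intro x y z w hr hz hy
    have h1 := mulWords_apply_of_not_red hn hm (hnod z y hz hy hr.not_bad) fun _ _ => hr.not_red
    rw [h0] at h1
    exact mul_ne_zero hz hy h1.symm
  by_cases hb : E.Bad σ x y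
  · obtain ⟨z, w, hr, ht⟩ : ∃ z w, E.Red σ x y z w ∧ E.Nod σ v (p₀ ++ z :: w :: q₀) := by
      suffices ∃ z w, E.Red σ x y z w ∧ E.Nod σ v (z :: w :: q₀) by
        obtain ⟨z, w, hr, hzw⟩ := this
        refine ⟨z, w, hr, Nod.append (u := E.rng z) ?_ hzw⟩
        exact (hn _ hx).1.replace_last hzw.valid rfl hr.src_eq fun _ => hr.bad_left
      have hlast := (hn _ hx).1.last
      have hq := (hm _ hy).1
      cases x with
      | edge α i =>
        cases y with
        | edge => exact hb.elim
        | ghost β j =>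
        obtain ⟨rfl, hα⟩ : α = β ∧ _ := hb
        -- Condition (LV) supplies a second edge `γ` of maximal weight, for which the indices `i`
        -- and `j` remain in range.
        have hmem : α ∈ E.out (E.s α) := mem_out.2 rfl
        have hcard := hE.two_le_card (E.s α) ⟨α, hmem⟩
        obtain ⟨γ, hγ, hne⟩ := Finset.exists_mem_ne hcard α
        rw [Finset.mem_filter, mem_out, ← hσ.weight α, hα] at hγ
        refine ⟨.edge γ i, .ghost γ j, .edge hα hne hγ.1, ?_⟩
        refine nod_cons.2 ⟨?_, rfl, ?_, ?_⟩
        · exact lt_of_lt_of_eq hlast.1 hγ.2.symm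
        · rintro ⟨-, h⟩
          rw [hγ.1, hα] at h
          exact hne h.symm
        · refine hq.1.replace_head ?_ hγ.1 ?_
          · exact lt_of_lt_of_eq hq.1.valid hγ.2.symm
          · rintro (_ | _) h
            · exact h
            · exact h
      | ghost α i =>
        cases y with
        | ghost => exact hb.elim
        | edge β j =>
        obtain ⟨rfl, rfl⟩ : i = 0 ∧ j = 0 := hb
        -- All weights are at least two, so index `1` is available for both letters.
        have h2 := hE.two_le_weight
        refine ⟨.ghost α 1, .edge β 1, .ghost le_rfl (h2 β), ?_⟩
        refine nod_cons.2 ⟨h2 α, hlast.2.trans hq.2.symm, ?_, ?_⟩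
        · rintro ⟨h, -⟩
          omega
        · refine hq.1.replace_head (h2 β) rfl ?_
          rintro (_ | _) h
          · exact h
          · exact h
    have h1 := mulWords_apply_of_red hn hm ht hr
    rw [h0, eq_comm, sub_eq_zero] at h1
    -- Vanishing at `p₀ z w q₀` equates two products, one of them nonzero; so `n (p₀ z)` is nonzero
    -- and the mixed word applies.
    refine hA x y z w hr (fun h => ?_) hy
    rw [h, zero_mul, eq_comm] at h1
    exact mul_ne_zero hx hy h1
  · by_cases hr : ∃ x₁ y₁, E.Red σ x₁ y₁ x y
    · obtain ⟨x₁, y₁, hr⟩ := hr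
      have h1 := mulWords_apply_of_red hn hm (hnod x y hx hy hb) hr
      rw [h0, eq_comm, sub_eq_zero] at h1
      -- The same equation now shows that `m (y₁ q₀)` is nonzero, and the mixed word is `p₀ x y₁
      -- q₀`.
      refine hA x₁ y₁ x y hr hx (fun h => ?_)
      rw [h, mul_zero] at h1
      exact mul_ne_zero hx hy h1
    · push Not at hr
      have h1 := mulWords_apply_of_not_red hn hm (hnod x y hx hy hb) hr
      rw [h0] at h1
      exact mul_ne_zero hx hy h1.symm

end Leading

end

end WeightedGraph

/-! ### Quasi-regularity in corners -/

namespace WeightedGraph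

noncomputable section

variable {V S : Type*} {E : WeightedGraph V S} {σ : V → S} {v : V} {R : Type*} [Ring R]

theorem IsLVGraph.exists_isSpecial (hE : E.IsLVGraph) : ∃ σ, E.IsSpecial σ := by
  classical
  obtain ⟨α₀⟩ := hE.has_edges
  have h : ∀ u, ∃ β, (E.out u).Nonempty → E.s β = u ∧ E.ω β = E.vertexWeight u := by
    intro u
    by_cases hu : (E.out u).Nonempty
    · have := hE.two_le_card u hu
      obtain ⟨β, hβ⟩ := Finset.card_pos.1 (lt_of_lt_of_le two_pos this)
      rw [Finset.mem_filter, mem_out] at hβ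
      exact ⟨β, fun _ => hβ⟩
    · exact ⟨α₀, fun h => absurd h hu⟩
  choose σ hσ using h
  exact ⟨σ, fun α => (hσ _ ⟨α, mem_out.2 rfl⟩).1, fun α => (hσ _ ⟨α, mem_out.2 rfl⟩).2⟩

open Classical in
theorem proj_apply (u : V) (m : List (Letter S) →₀ R) (l : List (Letter S)) :
    E.proj σ v R u m l = if E.Nod σ v l ∧ E.start v l = u then m l else 0 := by
  induction m using Finsupp.induction_linear with
  | zero => simp
  | add m n hm hn => rw [map_add, Finsupp.add_apply, hm, hn]; split_ifs <;> simp
  | single k c =>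
    rw [proj, Finsupp.linearCombination_single, Finsupp.smul_apply]
    by_cases hk : k = l
    · subst hk
      by_cases hn : E.Nod σ v k
      · by_cases hu : E.start v k = u <;> simp [hn, hu, bas_of_nod hn]
      · simp [hn, bas_of_not_nod hn]
    · have : E.bas σ v R k l = 0 := by
        by_cases hn : E.Nod σ v k
        · simp [bas_of_nod hn, hk]
        · simp [bas_of_not_nod hn]
      split_ifs <;> simp [hk, this]

theorem nod_and_start_of_proj_eq {u : V} {m : List (Letter S) →₀ R}
    (h : E.proj σ v R u m = m) {l : List (Letter S)} (hl : m l ≠ 0) :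
    E.Nod σ v l ∧ E.start v l = u := by
  classical
  rw [← h, proj_apply] at hl
  by_contra h'
  exact hl (if_neg h')

theorem exists_max_length {m : List (Letter S) →₀ R} (hm : m ≠ 0) :
    ∃ q, m q ≠ 0 ∧ ∀ l, m l ≠ 0 → l.length ≤ q.length := by
  obtain ⟨q, hq, h⟩ := m.support.exists_max_image List.length (Finsupp.support_nonempty_iff.2 hm)
  exact ⟨q, Finsupp.mem_support_iff.1 hq, fun l hl => h l (Finsupp.mem_support_iff.2 hl)⟩

theorem eq_single_nil {m : List (Letter S) →₀ R} (h : ∀ l, m l ≠ 0 → l.length ≤ 0) :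
    m = Finsupp.single [] (m []) := by
  classical
  ext l
  by_cases hl : l = []
  · simp [hl]
  · rw [Finsupp.single_eq_of_ne hl]
    by_contra h'
    exact hl (List.eq_nil_of_length_eq_zero (Nat.le_zero.1 (h l h')))

theorem mulWords_single (p : List (Letter S)) (c : R) (m : List (Letter S) →₀ R) :
    E.mulWords σ v R (Finsupp.single p c) m = c • E.actWord σ v R p m := by
  exact Finsupp.sum_single_index (zero_smul _ _)

/-- Multiplying with a letter on the left does not kill an element. -/
theorem exists_act_apply_ne_zero [IsDomain R] (hE : E.IsLVGraph) (hσ : E.IsSpecial σ)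
    {x : Letter S} {m : List (Letter S) →₀ R} (hx : E.Valid x)
    (hm : E.proj σ v R (E.rng x) m = m) (h0 : m ≠ 0) :
    ∃ q, q ≠ [] ∧ E.act σ v R x m q ≠ 0 := by
  obtain ⟨q, hq, hmax⟩ := exists_max_length h0
  cases q with
  | nil =>
    refine ⟨[x], by simp, ?_⟩
    have hv := (nod_and_start_of_proj_eq hm hq).2
    rw [eq_single_nil hmax, act_single, actBasis,
      bas_of_nod (show E.Nod σ v [x] from ⟨hx, hv.symm⟩)]
    simpa using hq
  | cons y q =>
    classical
    obtain ⟨t, ht, hne⟩ := exists_mulWords_apply_ne_zero (u := E.rng x) (v := v)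
      (n := Finsupp.single [x] 1) (m := m) (p₀ := []) (q₀ := q) (x := x) (y := y)
      (fun p hp => by
        have : p = [x] := by
          by_contra h
          exact hp (Finsupp.single_eq_of_ne h)
        subst this
        exact ⟨⟨hx, rfl⟩, le_rfl⟩)
      (fun l hl => ⟨nod_and_start_of_proj_eq hm hl, hmax l hl⟩) hE hσ (by simp) hq
    refine ⟨t, ?_, ?_⟩
    · rintro rfl
      simp at ht
    · rw [mulWords_single, one_smul] at hne
      exact hne

theorem rep_letterElt (x : Letter S) (m : List (Letter S) →₀ R) :
    E.rep σ v R (E.letterElt R x) m = E.act σ v R x m := by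
  cases x
  · exact rep_edg _ _ _
  · exact rep_gho _ _ _

theorem rep_wordElt (p : List (Letter S)) (m : List (Letter S) →₀ R) :
    E.rep σ v R (E.wordElt v R p) m = E.actWord σ v R p (E.proj σ v R v m) := by
  induction p with
  | nil => exact rep_vtx v m
  | cons x p ih => rw [wordElt, rep_mul, ih, rep_letterElt]; rfl

theorem rep_evalWords {n m : List (Letter S) →₀ R} (hn : ∀ p, n p ≠ 0 → E.Nod σ v p)
    (hm : E.proj σ v R v m = m) :
    E.rep σ v R (E.evalWords σ v R n) m = E.mulWords σ v R n m := by
  classical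
  rw [evalWords, Finsupp.linearCombination_apply, Finsupp.sum, rep_sum, mulWords, Finsupp.sum]
  refine Finset.sum_congr rfl fun p hp => ?_
  rw [if_pos (hn p (Finsupp.mem_support_iff.1 hp)), rep_smul, rep_wordElt, hm]

theorem evalWords_single_nil : E.evalWords σ v R (Finsupp.single [] 1) = E.vtx R v := by
  have h : E.Nod σ v [] := trivial
  rw [evalWords_single, one_smul, evalWords_bas_of_nod h, wordElt]

/-- Since `m = v m`, the element `f` acts on `m` as `f v` does, and `f v` evaluates to its normal
form. This turns the action into a product of normal forms, to which the leading-term argument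
applies. -/
theorem rep_eq_mulWords (hσ : E.IsSpecial σ) (f : E.FreeRRing R) {m : List (Letter S) →₀ R}
    (hm : E.proj σ v R v m = m) :
    E.rep σ v R f m = E.mulWords σ v R (E.rep σ v R f (Finsupp.single [] 1)) m := by
  rw [← rep_evalWords (fun p hp => nod_of_rep_ne_zero hp) hm]
  have h := toL_mul_evalWords (v := v) hσ f (Finsupp.single [] 1)
  rw [evalWords_single_nil] at h
  rw [← rep_eq_of_toL_eq hσ h, rep_mul, rep_vtx, hm]

/-- An element of positive degree in a corner is not left quasi-regular. -/
theorem not_isLeftQuasiregular [IsDomain R] (hE : E.IsLVGraph) (hσ : E.IsSpecial σ)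
    {f : E.FreeRRing R}
    (hf : E.proj σ v R v (E.rep σ v R f (Finsupp.single [] 1)) =
      E.rep σ v R f (Finsupp.single [] 1))
    (hpos : ∃ q, q ≠ [] ∧ E.rep σ v R f (Finsupp.single [] 1) q ≠ 0) :
    ¬ IsLeftQuasiregular (E.toL R f) := by
  rintro ⟨b, hb⟩
  obtain ⟨g, rfl⟩ := toL_surjective b
  rw [← map_add, ← map_mul] at hb
  have h := congrArg (fun φ => φ (Finsupp.single [] 1)) (rep_eq_of_toL_eq (v := v) hσ hb)
  simp only [rep_add, rep_mul] at h
  rw [rep_eq_mulWords hσ g hf] at h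
  have hnn : ∀ p, E.rep σ v R g (Finsupp.single [] 1) p ≠ 0 → E.Nod σ v p :=
    fun p hp => nod_of_rep_ne_zero hp
  generalize E.rep σ v R f (Finsupp.single [] 1) = m at *
  generalize E.rep σ v R g (Finsupp.single [] 1) = n at *
  obtain ⟨q', hq', hmq'⟩ := hpos
  have hm0 : m ≠ 0 := by
    rintro rfl
    exact hmq' rfl
  have hn0 : n ≠ 0 := by
    rintro rfl
    rw [mulWords, Finsupp.sum_zero_index, zero_add] at h
    exact hm0 h
  obtain ⟨q, hq, hqmax⟩ := exists_max_length hm0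
  obtain ⟨p, hp, hpmax⟩ := exists_max_length hn0
  cases q with
  | nil => exact hq' (List.eq_nil_of_length_eq_zero (Nat.le_zero.1 (hqmax q' hmq')))
  | cons y q =>
  obtain rfl | ⟨p, x, rfl⟩ := List.eq_nil_or_concat p
  -- Here `b v` is a scalar multiple of `v`. The coefficient of the longest word of `m` forces the
  -- scalar to be `1`, and then the empty word gives `1 = 0`.
  · rw [eq_single_nil hpmax, mulWords_single] at h
    have h1 := congrArg (fun φ => φ (y :: q)) h
    simp only [actWord, LinearMap.id_apply, Finsupp.add_apply, Finsupp.smul_apply,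
      smul_eq_mul] at h1
    rw [Finsupp.single_eq_of_ne (by simp), zero_add] at h1
    have h2 : n [] = 1 := (mul_eq_right₀ hq).1 h1.symm
    rw [h2, one_smul, actWord, LinearMap.id_apply, add_eq_right, Finsupp.single_eq_zero] at h
    exact one_ne_zero h
  · rw [List.concat_eq_append] at hp hpmax
    -- Both lengths are positive, so the product has a word longer than any in `n` or `m`.
    obtain ⟨t, ht, hne⟩ := exists_mulWords_apply_ne_zero (u := v) (v := v) (n := n) (m := m)
      (p₀ := p) (q₀ := q) (x := x) (y := y)
      (fun l hl => ⟨hnn l hl, by simpa using hpmax l hl⟩)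
      (fun l hl => ⟨nod_and_start_of_proj_eq hf hl, hqmax l hl⟩) hE hσ hp hq
    rw [← h, Finsupp.add_apply] at hne
    have h1 : n t ≠ 0 ∨ m t ≠ 0 := by
      by_contra! h2
      exact hne (by rw [h2.1, h2.2, add_zero])
    rcases h1 with h1 | h1
    · have := hpmax t h1
      simp at this
      omega
    · have := hqmax t h1
      simp at this
      omega

theorem Step.exists_letter {u w : V} (h : E.Step u w) :
    ∃ x : Letter S, E.Valid x ∧ E.src x = u ∧ E.rng x = w := by
  obtain ⟨α, i, ⟨h1, h2⟩ | ⟨h1, h2⟩⟩ := h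
  · exact ⟨.edge α i, i.2, h1, h2⟩
  · exact ⟨.ghost α i, i.2, h1, h2⟩

theorem IsLVGraph.exists_letter (hE : E.IsLVGraph) (u : V) :
    ∃ x : Letter S, E.Valid x ∧ E.rng x = u := by
  obtain ⟨α⟩ := hE.has_edges
  rcases Relation.ReflTransGen.cases_tail (hE.connected (E.s α) u) with h | ⟨w, -, h⟩
  · exact ⟨.ghost α 0, E.ω_pos α, h.symm⟩
  · obtain ⟨x, hx, -, hr⟩ := h.exists_letter
    exact ⟨x, hx, hr⟩

/-- Walking back along the generalised path, each left multiplication by a letter moves the starting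
vertex and preserves a term of positive length. -/
theorem exists_rep_mul_of_reach [IsDomain R] (hE : E.IsLVGraph) (hσ : E.IsSpecial σ) {u w : V}
    (h : E.Reach w u) {f : E.FreeRRing R} {m : List (Letter S) →₀ R}
    (hf : E.proj σ v R u (E.rep σ v R f m) = E.rep σ v R f m)
    (hpos : ∃ q, q ≠ [] ∧ E.rep σ v R f m q ≠ 0) :
    ∃ g, E.proj σ v R w (E.rep σ v R (g * f) m) = E.rep σ v R (g * f) m ∧
      ∃ q, q ≠ [] ∧ E.rep σ v R (g * f) m q ≠ 0 := by
  induction h generalizing f with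
  | refl =>
    refine ⟨E.vtx R w, ?_⟩
    rw [rep_mul, rep_vtx, hf]
    exact ⟨hf, hpos⟩
  | tail _ hs ih =>
    obtain ⟨x, hx, rfl, rfl⟩ := hs.exists_letter
    obtain ⟨q, -, hq⟩ := hpos
    have h0 : E.rep σ v R f m ≠ 0 := fun h => hq (by rw [h]; rfl)
    have h1 := exists_act_apply_ne_zero hE hσ hx hf h0
    have h2 : E.rep σ v R (E.letterElt R x * f) m = E.act σ v R x (E.rep σ v R f m) := by
      rw [rep_mul, rep_letterElt]
    obtain ⟨g, hg⟩ := ih (f := E.letterElt R x * f) (by rw [h2, proj_src_act]) (by rwa [h2])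
    exact ⟨g * E.letterElt R x, by rwa [mul_assoc]⟩

/-- Every nonzero element has a multiple of positive degree in some corner. -/
theorem exists_mul_of_toL_ne_zero [IsDomain R] (hE : E.IsLVGraph) (hσ : E.IsSpecial σ)
    {f : E.FreeRRing R} (hf : E.toL R f ≠ 0) :
    ∃ v g, E.proj σ v R v (E.rep σ v R (g * f * E.vtx R v) (Finsupp.single [] 1)) =
        E.rep σ v R (g * f * E.vtx R v) (Finsupp.single [] 1) ∧
      ∃ q, q ≠ [] ∧ E.rep σ v R (g * f * E.vtx R v) (Finsupp.single [] 1) q ≠ 0 := by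
  classical
  obtain ⟨v, hv⟩ := exists_toL_mul_vtx_ne_zero hf
  have h1 : E.rep σ v R (f * E.vtx R v) (Finsupp.single [] 1) =
      E.rep σ v R f (Finsupp.single [] 1) := by
    have hn : E.Nod σ v [] := trivial
    rw [rep_mul, rep_vtx, proj_single_one, proj_bas, start, if_pos rfl, bas_of_nod hn]
  have h2 : E.rep σ v R f (Finsupp.single [] 1) ≠ 0 := by
    intro h
    have := toL_mul_evalWords (v := v) hσ f (Finsupp.single [] 1)
    rw [evalWords_single_nil, h, map_zero, map_zero] at this
    exact hv this
  obtain ⟨l, hl⟩ := Finsupp.ne_iff.1 h2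
  have hl' : E.rep σ v R f (Finsupp.single [] 1) l ≠ 0 := hl
  -- One letter is prepended in any case, since the normal form of `f v` might be only a multiple of
  -- the empty word.
  obtain ⟨x, hx, hr⟩ := hE.exists_letter (E.start v l)
  have h3 : E.proj σ v R (E.rng x) (E.rep σ v R f (Finsupp.single [] 1)) ≠ 0 := by
    intro h
    have h4 := congrArg (fun φ => φ l) h
    simp only [proj_apply, Finsupp.zero_apply] at h4
    rw [if_pos ⟨nod_of_rep_ne_zero hl', hr.symm⟩] at h4
    exact hl' h4
  have h5 := exists_act_apply_ne_zero hE hσ hx (by rw [proj_proj, if_pos rfl]) h3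
  rw [act_proj_rng] at h5
  have h6 : E.rep σ v R (E.letterElt R x * (f * E.vtx R v)) (Finsupp.single [] 1) =
      E.act σ v R x (E.rep σ v R f (Finsupp.single [] 1)) := by
    rw [rep_mul, rep_letterElt, h1]
  obtain ⟨g, hg⟩ := exists_rep_mul_of_reach (v := v) hE hσ (hE.connected v (E.src x))
    (f := E.letterElt R x * (f * E.vtx R v)) (m := Finsupp.single [] 1)
    (by rw [h6, proj_src_act]) (by rwa [h6])
  exact ⟨v, g * E.letterElt R x, by simpa only [mul_assoc] using hg⟩

end

end WeightedGraph

/-- The hypothesis reads `(1 - c)(1 - ab) = 1` in a unitization. Then `1 + b(1 - c)a` is a left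
inverse of `1 - ba`, which gives the witness `bca - ba`. -/
theorem IsLeftQuasiregular.mul_comm {A : Type*} [NonUnitalRing A] {a b : A}
    (h : IsLeftQuasiregular (a * b)) : IsLeftQuasiregular (b * a) := by
  obtain ⟨c, hc⟩ := h
  refine ⟨b * c * a - b * a, ?_⟩
  have : b * (c * (a * b)) * a - b * (a * b) * a = b * c * a := by
    rw [← hc]
    noncomm_ring
  rw [sub_add_cancel]
  refine this.symm.trans ?_
  noncomm_ring

theorem mainTheorem10 {V S : Type*} [Countable V] [Countable S] (E : WeightedGraph V S)
    (hE : E.IsLVGraph) (R : Type*) [Ring R] [IsDomain R] :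
    jacobsonRadical (E.LeavittPathAlgebra R) = ⊥ := by
  rw [jacobsonRadical, sSup_eq_bot]
  intro I hI
  rw [AddSubgroup.eq_bot_iff_forall]
  intro a ha
  by_contra h0
  obtain ⟨σ, hσ⟩ := hE.exists_isSpecial
  obtain ⟨f, rfl⟩ := WeightedGraph.toL_surjective a
  obtain ⟨v, g, h1, h2⟩ := WeightedGraph.exists_mul_of_toL_ne_zero hE hσ h0
  refine WeightedGraph.not_isLeftQuasiregular hE hσ h1 h2 ?_
  rw [map_mul]
  -- A left ideal is not closed under right multiplication by `v`; but it contains `v g a`, and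
  -- exchanging the factors `v` and `g a` reaches `g a v`.
  refine IsLeftQuasiregular.mul_comm (hI.quasiregular _ ?_)
  rw [map_mul]
  exact hI.mul_mem _ _ (hI.mul_mem _ _ ha)
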